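/- Let $0<q<1$, $-1<s<0$, $k\in\mathbb{Z}_{\ge 1}$, and let $\mathrm{Sign}_k^+$ be the set of integer sequences $\lambda=(\lambda_1\ge\dots\ge\lambda_k\ge 0)$. Write $(z;q)_n=\prod_{j=0}^{n-1}(1-zq^j)$ and, for $\lambda\in\mathrm{Sign}_k^+$, $$c(\lambda)=\prod_{m\ge 0}\frac{(s^2;q)_{n_m}}{(q;q)_{n_m}},\qquad n_m=\#\{i:\lambda_i=m\},$$ $$F_\lambda(u_1,\dots,u_k)=\frac{(1-q)^k}{\prod_{i=1}^k(1-su_i)}\sum_{\sigma\in\mathfrak{S}_k}\ \prod_{1\le\alpha<\beta\le k}\frac{u_{\sigma(\alpha)}-qu_{\sigma(\beta)}}{u_{\sigma(\alpha)}-u_{\sigma(\beta)}}\ \prod_{i=1}^k\left(\frac{u_{\sigma(i)}-s}{1-su_{\sigma(i)}}\right)^{\lambda_i},$$ a symmetric rational function whose singularities at $u_\alpha=u_\beta$ are removable, and $F^c_\lambda=c(\lambda)F_\lambda$. Contours are piecewise continuously differentiable simple closed curves with positive orientation; $q\gamma$ denotes the image of $\gamma$ under multiplication by $q$. Let $\lambda,\mu\in\mathrm{Sign}_k^+$.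 (1) (Theorem 7.4.) Let $\gamma_1^+[s],\dots,\gamma_k^+[s]$ be contours such that each of them encircles $s$ and leaves $s^{-1}$ outside, for all $\beta>\alpha$ the interior of $\gamma_\alpha^+[s]$ contains $q\gamma_\beta^+[s]$, and $\gamma_k^+[s]$ does not intersect $q\gamma_k^+[s]$. Then the following integral converges absolutely and $$\oint_{\gamma_1^+[s]}\frac{du_1}{2\pi i}\cdots\oint_{\gamma_k^+[s]}\frac{du_k}{2\pi i}\prod_{1\le\alpha<\beta\le k}\frac{u_\alpha-u_\beta}{u_\alpha-qu_\beta}\,F_\lambda^c(u_1,\dots,u_k)\prod_{i=1}^k\frac{1}{u_i-s}\left(\frac{1-su_i}{u_i-s}\right)^{\mu_i}=\mathbf 1_{\lambda=\mu}.$$ (2) (Corollary 7.5, spatial biorthogonality.) Let $\gamma[s;0]$ be a contour that encircles $s,qs,\dots,q^{k-1}s$, contains $q\gamma[s;0]$ in its interior and leaves $s^{-1}$ outside (hence it encircles $0$). Then the following integral converges absolutely and $$\frac{c(\lambda)}{(1-q)^k\,k!}\oint_{\gamma[s;0]}\frac{du_1}{2\pi i u_1}\cdots\oint_{\gamma[s;0]}\frac{du_k}{2\pi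 i u_k}\prod_{1\le\alpha\ne\beta\le k}\frac{u_\alpha-u_\beta}{u_\alpha-qu_\beta}\,F_\lambda(u_1,\dots,u_k)\,F_\mu(u_1^{-1},\dots,u_k^{-1})=\mathbf 1_{\lambda=\mu}.$$ -/

import Mathlib

open Set MeasureTheory

noncomputable section

namespace SpinOrthogonality

/-! ## Signatures and the symmetric rational functions -/

/-- Nonnegative signatures of length `k`: sequences `lam 0 ≥ lam 1 ≥ ... ≥ lam (k-1) ≥ 0` of
integers. -/
abbrev Signature (k : ℕ) : Type := {lam : Fin k → ℕ // Antitone lam}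

/-- The finite `q`-Pochhammer symbol `(z; q)_n = (1 - z) (1 - z q) ... (1 - z q^(n-1))`. -/
def qPoch (z q : ℂ) (n : ℕ) : ℂ := ∏ j ∈ Finset.range n, (1 - z * q ^ j)

/-- The number of parts of `lam` that are equal to `m`. -/
def multiplicity {k : ℕ} (lam : Signature k) (m : ℕ) : ℕ :=
  (Finset.univ.filter fun i : Fin k => lam.1 i = m).card

/-- The constant `c(lam) = ∏_m (s^2; q)_{n_m} / (q; q)_{n_m}`, where `n_m` is the multiplicity of
`m` in `lam`. Only the values `m` that occur in `lam` contribute a factor different from `1`. -/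
def cConst (q s : ℂ) {k : ℕ} (lam : Signature k) : ℂ :=
  ∏ m ∈ Finset.univ.image lam.1,
    qPoch (s ^ 2) q (multiplicity lam m) / qPoch q q (multiplicity lam m)

/-- The symmetric rational function
`F_lam(u) = (1-q)^k / ∏ (1 - s u_i) * ∑_σ σ (∏_{α<β} (u_α - q u_β)/(u_α - u_β) *
  ∏_i ((u_i - s)/(1 - s u_i))^{lam_i})`,
where `σ` permutes the variables. As a rational function it is regular where some of the `u_i`
coincide. The expression below does not have the right value at those points, but in both integrands
`nestedIntegrand` and `symmetricIntegrand` it is multiplied by all the differences `u_α - u_β`, so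
that these integrands have the right value, `0`, there. -/
def F (q s : ℂ) {k : ℕ} (lam : Signature k) (u : Fin k → ℂ) : ℂ :=
  (1 - q) ^ k / (∏ i, (1 - s * u i)) *
    ∑ σ : Equiv.Perm (Fin k),
      (∏ α, ∏ β ∈ Finset.Ioi α, (u (σ α) - q * u (σ β)) / (u (σ α) - u (σ β))) *
        ∏ i, ((u (σ i) - s) / (1 - s * u (σ i))) ^ lam.1 i

/-- The conjugated function `F^c_lam = c(lam) F_lam`. -/
def Fc (q s : ℂ) {k : ℕ} (lam : Signature k) (u : Fin k → ℂ) : ℂ :=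
  cConst q s lam * F q s lam u

/-! ## Contours -/

/-- The winding number `(2πi)⁻¹ ∮ dw / (w - z)` around `z` of a closed curve parametrized by
`[0, 1]`. -/
def windingNumber (γ : ℝ → ℂ) (z : ℂ) : ℂ :=
  (2 * Real.pi * Complex.I)⁻¹ * ∫ t in (0 : ℝ)..1, deriv γ t / (γ t - z)

/-- A positively oriented closed contour: a piecewise continuously differentiable simple closed
curve, parametrized by `[0, 1]`, that winds zero times or once counterclockwise around each point
off the curve. -/
structure Contour where
  /-- the parametrization; only its values on `[0, 1]` matter -/
  toFun : ℝ → ℂ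
  continuousOn : ContinuousOn toFun (Icc 0 1)
  piecewise_C1 : ∃ P : Finset ℝ, ∃ C : ℝ, ∀ t ∈ Ioo (0 : ℝ) 1, t ∉ P →
    DifferentiableAt ℝ toFun t ∧ ContinuousAt (deriv toFun) t ∧ ‖deriv toFun t‖ ≤ C
  closed : toFun 0 = toFun 1
  simple : InjOn toFun (Ico 0 1)
  positive : ∀ z, z ∉ toFun '' Icc 0 1 → windingNumber toFun z = 0 ∨ windingNumber toFun z = 1

namespace Contour

/-- The set of points on the contour. -/
def trace (γ : Contour) : Set ℂ := γ.toFun '' Icc 0 1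

/-- The interior of the contour: the points that it encircles. -/
def inside (γ : Contour) : Set ℂ := {z | z ∉ γ.trace ∧ windingNumber γ.toFun z = 1}

/-- The exterior of the contour. -/
def outside (γ : Contour) : Set ℂ := {z | z ∉ γ.trace ∧ windingNumber γ.toFun z = 0}

end Contour

/-- The integrand on `[0, 1]^k` of the contour integral of `f` over `γ 0 × ... × γ (k-1)`. -/
def pullback {k : ℕ} (γ : Fin k → Contour) (f : (Fin k → ℂ) → ℂ) (t : Fin k → ℝ) : ℂ :=
  (∏ i, deriv (γ i).toFun (t i)) * f fun i => (γ i).toFun (t i)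

/-- The contour integral of `f` over `γ 0 × ... × γ (k-1)` converges absolutely. -/
def ContourIntegrable {k : ℕ} (γ : Fin k → Contour) (f : (Fin k → ℂ) → ℂ) : Prop :=
  IntegrableOn (pullback γ f) (Icc (0 : Fin k → ℝ) 1)

/-- The normalized `k`-fold contour integral `∮_{γ 0} du_0/(2πi) ... ∮_{γ (k-1)} du_{k-1}/(2πi)
f(u)`, as an integral over the cube `[0, 1]^k`. -/
def contourIntegral {k : ℕ} (γ : Fin k → Contour) (f : (Fin k → ℂ) → ℂ) : ℂ :=
  ((2 * Real.pi * Complex.I) ^ k)⁻¹ * ∫ t in Icc (0 : Fin k → ℝ) 1, pullback γ f t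

/-- The `q`-nested contours `γ_1^+[s], ..., γ_k^+[s]`. -/
structure IsNested (q s : ℝ) {k : ℕ} (γ : Fin k → Contour) : Prop where
  encircles : ∀ α, (s : ℂ) ∈ (γ α).inside
  leaves_outside : ∀ α, (s : ℂ)⁻¹ ∈ (γ α).outside
  /-- for `α < β` the interior of `γ_α` contains the contour `q γ_β` -/
  nested : ∀ α β, α < β → ∀ z ∈ (γ β).trace, (q : ℂ) * z ∈ (γ α).inside
  /-- the last contour does not intersect its image under multiplication by `q` -/
  small : ∀ α : Fin k, (α : ℕ) + 1 = k → ∀ z ∈ (γ α).trace, (q : ℂ) * z ∉ (γ α).trace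

/-- The large contour `γ[s; 0]` (the point `0` is then automatically inside it). -/
structure IsLarge (q s : ℝ) (k : ℕ) (γ : Contour) : Prop where
  encircles : ∀ j < k, (q : ℂ) ^ j * (s : ℂ) ∈ γ.inside
  leaves_outside : (s : ℂ)⁻¹ ∈ γ.outside
  /-- the interior of `γ` contains the contour `q γ` -/
  nested : ∀ z ∈ γ.trace, (q : ℂ) * z ∈ γ.inside

/-! ## The two integrands -/

/-- `∏_{α<β} (u_α - u_β)/(u_α - q u_β) * F^c_lam(u) *
  ∏_i 1/(u_i - s) * ((1 - s u_i)/(u_i - s))^{mu_i}`. -/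
def nestedIntegrand (q s : ℂ) {k : ℕ} (lam mu : Signature k) (u : Fin k → ℂ) : ℂ :=
  (∏ α, ∏ β ∈ Finset.Ioi α, (u α - u β) / (u α - q * u β)) * Fc q s lam u *
    ∏ i, 1 / (u i - s) * ((1 - s * u i) / (u i - s)) ^ mu.1 i

/-- `∏_i 1/u_i * ∏_{α≠β} (u_α - u_β)/(u_α - q u_β) * F_lam(u) * F_mu(u_1⁻¹, ..., u_k⁻¹)`. -/
def symmetricIntegrand (q s : ℂ) {k : ℕ} (lam mu : Signature k) (u : Fin k → ℂ) : ℂ :=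
  (∏ i, 1 / u i) *
    (∏ α, ∏ β ∈ Finset.univ.erase α, (u α - u β) / (u α - q * u β)) *
      F q s lam u * F q s mu fun i => (u i)⁻¹

end SpinOrthogonality

end

/-!
All integrands are rational, so that Cauchy's theorem is needed only for rational functions of one
variable, where it follows from partial fractions and primitives (`RationalOn.cauchyIntegral_eq_zero`
and `RationalOn.cauchyIntegral_inv_sub_mul`). This makes it possible to work with winding numbers
alone, without the Jordan curve theorem. The positions of the poles come from two facts about a
contour `γ` that contains `q γ'` in its interior: the points of `γ` lie outside `q γ'`
(`Contour.div_mem_outside`), and `γ` also contains `q` times the interior of `γ'`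
(`Contour.mul_mem_inside`).

The product over `u α - u β` cancels the denominators of `F`, and the nested integrand becomes a sum
over permutations `σ` of terms in which the variables `u a`, `u b` with `a < b` interact through
`(u b - q * u a) / (u a - q * u b)` if `σ` inverts the pair, and not at all otherwise
(`nestedIntegrand_eq_sum`). Let `c` be the largest element of a set
`{c | m ≤ lam (σ⁻¹ c)}`. All interaction poles of the variable `c` are outside its contour, and if
`mu c < lam (σ⁻¹ c)` then so is its only other pole `s⁻¹`, so the integral over this variable is `0`.
Symmetrically, for the smallest element `c` of a set `{c | lam (σ⁻¹ c) ≤ m}` with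
`lam (σ⁻¹ c) < mu c` all poles are inside and there is no residue at infinity. A term that survives
therefore satisfies `lam ∘ σ⁻¹ = mu`
(`comp_symm_eq_of_contourIntegral_permTerm_ne_zero`), which forces `lam = mu`.

For `lam = mu` the sum runs over the permutations that preserve `lam`. By the symmetrization identity
`sum_sign_mul_prod_sub`, a consequence of Lagrange interpolation, it equals a product of `q`-integers
times an integrand in which only variables with equal parts of `lam` interact. That one is integrated
out starting from the last variable, with a single residue at each step
(`contourIntegral_labelledIntegrand`), and the result is the inverse of the normalization.

For the symmetric form, `F_mu(u⁻¹)` is expanded over permutations: each of them contributes the nested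
integrand in permuted variables, and a large contour, repeated `k` times, is nested.
-/

namespace SpinOrthogonality

/-! ### One-dimensional contour integrals -/

/-- The normalized contour integral `(2πi)⁻¹ ∮_γ f(w) dw` of a function of one variable, written
as an integral over `[0, 1]` so that it iterates to `contourIntegral`. -/
noncomputable def cauchyIntegral (γ : Contour) (f : ℂ → ℂ) : ℂ :=
  (2 * Real.pi * Complex.I)⁻¹ * ∫ t in Icc (0 : ℝ) 1, deriv γ.toFun t * f (γ.toFun t)

lemma two_pi_I_ne_zero : (2 * Real.pi * Complex.I : ℂ) ≠ 0 := Complex.two_pi_I_ne_zero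

namespace Contour

variable (γ : Contour)

lemma isCompact_trace : IsCompact γ.trace := isCompact_Icc.image_of_continuousOn γ.continuousOn

lemma mem_trace {t : ℝ} (ht : t ∈ Icc (0 : ℝ) 1) : γ.toFun t ∈ γ.trace := mem_image_of_mem _ ht

lemma isPreconnected_trace : IsPreconnected γ.trace :=
  isPreconnected_Icc.image _ γ.continuousOn

lemma nonempty_trace : γ.trace.Nonempty := ⟨_, γ.mem_trace ⟨le_rfl, zero_le_one⟩⟩

/-- The derivative is bounded almost everywhere: away from the finitely many breakpoints and the two
end points, where `deriv` may be a junk value. -/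
lemma exists_deriv_bound :
    ∃ C : ℝ, ∀ᵐ t ∂(volume.restrict (Icc (0 : ℝ) 1)), ‖deriv γ.toFun t‖ ≤ C := by
  obtain ⟨P, C, h⟩ := γ.piecewise_C1
  refine ⟨C, ?_⟩
  rw [ae_restrict_iff' measurableSet_Icc]
  have h0 : ∀ᵐ t : ℝ, t ∉ ((P ∪ {0, 1} : Finset ℝ) : Set ℝ) :=
    (Finset.countable_toSet _).ae_notMem volume
  filter_upwards [h0] with t ht ht1
  simp only [Finset.coe_union, Finset.coe_insert, Finset.coe_singleton, mem_union,
    Finset.mem_coe, mem_insert_iff, mem_singleton_iff, not_or] at ht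
  exact (h t ⟨lt_of_le_of_ne ht1.1 (Ne.symm ht.2.1), lt_of_le_of_ne ht1.2 ht.2.2⟩ ht.1).2.2

lemma integrable_deriv : Integrable (deriv γ.toFun) (volume.restrict (Icc (0 : ℝ) 1)) := by
  obtain ⟨C, hC⟩ := γ.exists_deriv_bound
  exact Integrable.of_bound (measurable_deriv _).aestronglyMeasurable C hC

lemma integrable_mul_comp {f : ℂ → ℂ} (hf : ContinuousOn f γ.trace) :
    Integrable (fun t => deriv γ.toFun t * f (γ.toFun t)) (volume.restrict (Icc (0 : ℝ) 1)) := by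
  have hc : ContinuousOn (fun t => f (γ.toFun t)) (Icc (0 : ℝ) 1) :=
    hf.comp γ.continuousOn fun t ht => γ.mem_trace ht
  obtain ⟨C, hC⟩ := isCompact_Icc.exists_bound_of_continuousOn hc
  refine γ.integrable_deriv.mul_bdd (c := C) (hc.aestronglyMeasurable measurableSet_Icc) ?_
  exact (ae_restrict_iff' measurableSet_Icc).2 (Filter.Eventually.of_forall hC)

lemma cauchyIntegral_inv_sub (z : ℂ) :
    cauchyIntegral γ (fun w => (w - z)⁻¹) = windingNumber γ.toFun z := by
  simp only [cauchyIntegral, windingNumber, div_eq_mul_inv]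
  rw [intervalIntegral.integral_of_le zero_le_one, integral_Icc_eq_integral_Ioc]

lemma cauchyIntegral_congr {f g : ℂ → ℂ} (h : EqOn f g γ.trace) :
    cauchyIntegral γ f = cauchyIntegral γ g := by
  unfold cauchyIntegral
  congr 1
  refine setIntegral_congr_fun measurableSet_Icc fun t ht => ?_
  simp only [h (γ.mem_trace ht)]

lemma cauchyIntegral_add {f g : ℂ → ℂ} (hf : ContinuousOn f γ.trace)
    (hg : ContinuousOn g γ.trace) :
    cauchyIntegral γ (fun w => f w + g w) = cauchyIntegral γ f + cauchyIntegral γ g := by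
  unfold cauchyIntegral
  simp only [mul_add]
  rw [integral_add (γ.integrable_mul_comp hf) (γ.integrable_mul_comp hg), mul_add]

lemma cauchyIntegral_const_mul (c : ℂ) (f : ℂ → ℂ) :
    cauchyIntegral γ (fun w => c * f w) = c * cauchyIntegral γ f := by
  unfold cauchyIntegral
  simp only [mul_left_comm _ c]
  rw [integral_const_mul]
  ring

/-- The integral of a derivative over a closed contour vanishes. -/
lemma cauchyIntegral_eq_zero_of_hasDerivAt {f g : ℂ → ℂ}
    (h : ∀ z ∈ γ.trace, HasDerivAt g (f z) z) (hf : ContinuousOn f γ.trace) :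
    cauchyIntegral γ f = 0 := by
  obtain ⟨P, C, hP⟩ := γ.piecewise_C1
  have hg : ContinuousOn g γ.trace := fun z hz => (h z hz).continuousAt.continuousWithinAt
  have key := integral_eq_of_hasDerivAt_off_countable_of_le (fun t => g (γ.toFun t))
    (fun t => deriv γ.toFun t * f (γ.toFun t)) zero_le_one (Finset.countable_toSet P)
    (hg.comp γ.continuousOn fun t ht => γ.mem_trace ht)
    (fun t ht => by
      have h1 := (hP t ht.1 ht.2).1.hasDerivAt
      have h2 := (h _ (γ.mem_trace (Ioo_subset_Icc_self ht.1))).comp_of_eq t h1 rfl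
      rw [mul_comm]
      exact h2)
    ((intervalIntegrable_iff_integrableOn_Icc_of_le zero_le_one).2 (γ.integrable_mul_comp hf))
  rw [intervalIntegral.integral_of_le zero_le_one, ← integral_Icc_eq_integral_Ioc,
    γ.closed, sub_self] at key
  rw [cauchyIntegral, key, mul_zero]

/-! ### Winding numbers -/

lemma continuousOn_inv_sub {z : ℂ} (hz : z ∉ γ.trace) :
    ContinuousOn (fun w => (w - z)⁻¹) γ.trace :=
  ContinuousOn.inv₀ (by fun_prop) fun w hw => sub_ne_zero.2 fun e => hz (e ▸ hw)

lemma continuousOn_windingNumber : ContinuousOn (windingNumber γ.toFun) γ.traceᶜ := by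
  have hopen : IsOpen γ.traceᶜ := γ.isCompact_trace.isClosed.isOpen_compl
  intro z hz
  refine ContinuousAt.continuousWithinAt ?_
  obtain ⟨ε, hε, hball⟩ := Metric.isOpen_iff.1 hopen z hz
  obtain ⟨C, hC⟩ := γ.exists_deriv_bound
  have h : ContinuousOn (fun w => cauchyIntegral γ (fun v => (v - w)⁻¹))
      (Metric.ball z (ε / 2)) := by
    refine continuousOn_const.mul ?_
    have hsub : ∀ w ∈ Metric.ball z (ε / 2), ∀ v ∈ γ.trace, ε / 2 ≤ ‖v - w‖ := by
      intro w hw v hv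
      by_contra! hlt
      have : v ∈ Metric.ball z ε := by
        rw [Metric.mem_ball] at hw ⊢
        calc dist v z ≤ dist v w + dist w z := dist_triangle _ _ _
          _ < ε / 2 + ε / 2 := add_lt_add (by rwa [dist_eq_norm]) hw
          _ = ε := by ring
      exact hball this hv
    refine continuousOn_of_dominated (bound := fun _ => C * (ε / 2)⁻¹) ?_ ?_ ?_ ?_
    · intro w hw
      refine (γ.integrable_mul_comp (γ.continuousOn_inv_sub fun hwt => ?_)).aestronglyMeasurable
      have := hsub w hw w hwt
      simp only [sub_self, norm_zero] at this
      linarith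
    · intro w hw
      filter_upwards [hC, ae_restrict_mem measurableSet_Icc] with t ht ht1
      rw [norm_mul, norm_inv]
      have h1 := hsub w hw _ (γ.mem_trace ht1)
      exact mul_le_mul ht (inv_anti₀ (by positivity) h1) (by positivity)
        ((norm_nonneg _).trans ht)
    · exact integrable_const _
    · filter_upwards [ae_restrict_mem measurableSet_Icc] with t ht1
      refine continuousOn_const.mul (ContinuousOn.inv₀ (by fun_prop) fun w hw e => ?_)
      have := hsub w hw _ (γ.mem_trace ht1)
      rw [e, norm_zero] at this
      linarith
  simp only [cauchyIntegral_inv_sub] at h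
  exact h.continuousAt (Metric.ball_mem_nhds z (by positivity))

/-- The winding number is constant on connected sets that avoid the contour. -/
lemma windingNumber_eq_of_isPreconnected {S : Set ℂ} (hS : IsPreconnected S)
    (hd : ∀ z ∈ S, z ∉ γ.trace) {x y : ℂ} (hx : x ∈ S) (hy : y ∈ S) :
    windingNumber γ.toFun x = windingNumber γ.toFun y :=
  hS.constant_of_mapsTo (T := ({0, 1} : Set ℂ))
    (Set.Finite.isDiscrete (by simp))
    (γ.continuousOn_windingNumber.mono hd)
    (fun z hz => by
      rcases γ.positive z (hd z hz) with h | h <;> simp [h]) hx hy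

/-- A contour does not wind around points that are at least as far from `0` as all its points. -/
lemma mem_outside_of_norm_le {z : ℂ} (hz : z ∉ γ.trace) (h : ∀ w ∈ γ.trace, ‖w‖ ≤ ‖z‖) :
    z ∈ γ.outside := by
  refine ⟨hz, ?_⟩
  have hz0 : z ≠ 0 := by
    rintro rfl
    obtain ⟨w, hw⟩ := γ.nonempty_trace
    have := h w hw
    rw [norm_zero, norm_le_zero_iff] at this
    exact hz (this ▸ hw)
  have hzp : 0 < ‖z‖ := norm_pos_iff.2 hz0
  have hray : IsPreconnected ((fun r : ℝ => (r : ℂ) * z) '' Ici 1) :=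
    isPreconnected_Ici.image _ (by fun_prop)
  have hd : ∀ v ∈ (fun r : ℝ => (r : ℂ) * z) '' Ici 1, v ∉ γ.trace := by
    rintro _ ⟨r, hr, rfl⟩ hv
    have h1 := h _ hv
    rw [norm_mul, Complex.norm_real, Real.norm_of_nonneg (zero_le_one.trans hr)] at h1
    have hr1 : r = 1 := le_antisymm (by nlinarith) hr
    simp only [hr1, Complex.ofReal_one, one_mul] at hv
    exact hz hv
  have hconst : ∀ r : ℝ, 1 ≤ r →
      windingNumber γ.toFun (r * z) = windingNumber γ.toFun z := fun r hr =>
    γ.windingNumber_eq_of_isPreconnected hray hd ⟨r, hr, rfl⟩ ⟨1, mem_Ici.2 le_rfl, by simp⟩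
  obtain ⟨C, hC⟩ := γ.exists_deriv_bound
  -- along the ray through `z` the winding number is `O(1/r)`, so its constant value is `0`
  have hbound : ∀ r : ℝ, 1 < r → ‖windingNumber γ.toFun z‖ ≤
      ‖(2 * Real.pi * Complex.I : ℂ)⁻¹‖ * (C * ((r - 1) * ‖z‖)⁻¹) := by
    intro r hr
    rw [← hconst r hr.le, ← cauchyIntegral_inv_sub, cauchyIntegral, norm_mul]
    refine mul_le_mul_of_nonneg_left ?_ (norm_nonneg _)
    have hpos : 0 < (r - 1) * ‖z‖ := mul_pos (by linarith) hzp
    have := norm_integral_le_of_norm_le_const (μ := volume.restrict (Icc (0 : ℝ) 1))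
      (f := fun t => deriv γ.toFun t * (γ.toFun t - r * z)⁻¹) (C := C * ((r - 1) * ‖z‖)⁻¹) (by
        filter_upwards [hC, ae_restrict_mem measurableSet_Icc] with t ht ht1
        rw [norm_mul, norm_inv]
        refine mul_le_mul ht (inv_anti₀ hpos ?_) (by positivity) ((norm_nonneg _).trans ht)
        have h2 := norm_sub_norm_le ((r : ℂ) * z) (γ.toFun t)
        rw [norm_mul, Complex.norm_real, Real.norm_of_nonneg (by linarith), norm_sub_rev] at h2
        have h3 := h _ (γ.mem_trace ht1)
        linarith)
    simpa using this
  have hlim : Filter.Tendsto (fun r : ℝ => ‖(2 * Real.pi * Complex.I : ℂ)⁻¹‖ *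
      (C * ((r - 1) * ‖z‖)⁻¹)) Filter.atTop (nhds (‖(2 * Real.pi * Complex.I : ℂ)⁻¹‖ * (C * 0))) := by
    refine (Filter.Tendsto.const_mul _ (Filter.Tendsto.const_mul _ ?_))
    refine Filter.Tendsto.inv_tendsto_atTop ?_
    exact (Filter.tendsto_atTop_add_const_right _ _ Filter.tendsto_id).atTop_mul_const hzp
  have h0 := ge_of_tendsto hlim ((Filter.eventually_gt_atTop 1).mono hbound)
  simpa using h0

/-- If `q γ'` lies inside `γ`, then every point of `γ` lies outside `q γ'`. -/
lemma div_mem_outside {γ γ' : Contour} {q : ℂ} (hq : q ≠ 0)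
    (h : ∀ z ∈ γ'.trace, q * z ∈ γ.inside) {u : ℂ} (hu : u ∈ γ.trace) : u / q ∈ γ'.outside := by
  have hd : ∀ z ∈ (fun v => v / q) '' γ.trace, z ∉ γ'.trace := by
    rintro _ ⟨v, hv, rfl⟩ hv'
    have := h _ hv'
    rw [mul_div_cancel₀ _ hq] at this
    exact this.1 hv
  have hconn : IsPreconnected ((fun v => v / q) '' γ.trace) :=
    γ.isPreconnected_trace.image _ (by fun_prop)
  -- the point of `γ` farthest from `0` is outside `q γ'`
  obtain ⟨m, hm, hmax⟩ := γ.isCompact_trace.exists_isMaxOn γ.nonempty_trace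
    (continuous_norm.continuousOn (s := γ.trace))
  have hlt : ∀ w ∈ γ'.trace, ‖w‖ ≤ ‖m / q‖ := by
    intro w hw
    by_contra! hlt
    rw [norm_div, div_lt_iff₀ (norm_pos_iff.2 hq)] at hlt
    have h1 := h w hw
    have h2 := γ.mem_outside_of_norm_le h1.1 fun v hv => by
      have := hmax hv
      simp only [mem_ofPred_eq] at this
      rw [norm_mul, mul_comm]
      linarith
    have := h1.2.symm.trans h2.2
    exact one_ne_zero this
  have hout := γ'.mem_outside_of_norm_le (hd _ ⟨m, hm, rfl⟩) hlt
  refine ⟨hd _ ⟨u, hu, rfl⟩, ?_⟩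
  rw [γ'.windingNumber_eq_of_isPreconnected hconn hd ⟨u, hu, rfl⟩ ⟨m, hm, rfl⟩]
  exact hout.2

/-- If `q γ'` lies inside `γ`, then so does the image under multiplication by `q` of the interior
of `γ'`. This is obtained by integrating `1 / ((v - q w) (w - z))` over `v ∈ γ` and `w ∈ γ'` in
both orders. -/
lemma mul_mem_inside {γ γ' : Contour} {q : ℂ} (hq : q ≠ 0)
    (h : ∀ z ∈ γ'.trace, q * z ∈ γ.inside) {z : ℂ} (hz : z ∈ γ'.inside) : q * z ∈ γ.inside := by
  have hnot : q * z ∉ γ.trace := fun hmem => by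
    have := (div_mem_outside hq h hmem).2
    rw [mul_div_cancel_left₀ _ hq, hz.2] at this
    exact one_ne_zero this
  refine ⟨hnot, ?_⟩
  have hne1 : ∀ v ∈ γ.trace, ∀ w ∈ γ'.trace, v - q * w ≠ 0 := fun v hv w hw e =>
    (h w hw).1 (sub_eq_zero.1 e ▸ hv)
  have hne2 : ∀ w ∈ γ'.trace, w - z ≠ 0 := fun w hw e => hz.1 (sub_eq_zero.1 e ▸ hw)
  have hint : Integrable (Function.uncurry fun t r : ℝ => deriv γ.toFun t * deriv γ'.toFun r *
      ((γ.toFun t - q * γ'.toFun r)⁻¹ * (γ'.toFun r - z)⁻¹))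
      ((volume.restrict (Icc (0 : ℝ) 1)).prod (volume.restrict (Icc (0 : ℝ) 1))) := by
    have hc : ContinuousOn (fun p : ℝ × ℝ => (γ.toFun p.1 - q * γ'.toFun p.2)⁻¹ *
        (γ'.toFun p.2 - z)⁻¹) (Icc (0 : ℝ) 1 ×ˢ Icc (0 : ℝ) 1) := by
      have c1 : ContinuousOn (fun p : ℝ × ℝ => γ.toFun p.1) (Icc (0 : ℝ) 1 ×ˢ Icc (0 : ℝ) 1) :=
        γ.continuousOn.comp continuousOn_fst fun p hp => hp.1
      have c2 : ContinuousOn (fun p : ℝ × ℝ => γ'.toFun p.2) (Icc (0 : ℝ) 1 ×ˢ Icc (0 : ℝ) 1) :=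
        γ'.continuousOn.comp continuousOn_snd fun p hp => hp.2
      refine ContinuousOn.mul (ContinuousOn.inv₀ (by fun_prop) fun p hp => ?_)
        (ContinuousOn.inv₀ (by fun_prop) fun p hp => ?_)
      · exact hne1 _ (γ.mem_trace hp.1) _ (γ'.mem_trace hp.2)
      · exact hne2 _ (γ'.mem_trace hp.2)
    obtain ⟨C, hC⟩ := (isCompact_Icc.prod isCompact_Icc).exists_bound_of_continuousOn hc
    have hm : MeasurableSet (Icc (0 : ℝ) 1 ×ˢ Icc (0 : ℝ) 1) :=
      measurableSet_Icc.prod measurableSet_Icc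
    refine (γ.integrable_deriv.mul_prod γ'.integrable_deriv).mul_bdd (c := C) ?_ ?_
    · rw [Measure.prod_restrict]
      exact hc.aestronglyMeasurable hm
    · rw [Measure.prod_restrict]
      exact (ae_restrict_iff' hm).2 (Filter.Eventually.of_forall hC)
  have hswap := integral_integral_swap hint
  have hL : ∀ t ∈ Icc (0 : ℝ) 1, ∫ r in Icc (0 : ℝ) 1, deriv γ.toFun t * deriv γ'.toFun r *
      ((γ.toFun t - q * γ'.toFun r)⁻¹ * (γ'.toFun r - z)⁻¹) =
      2 * Real.pi * Complex.I * (deriv γ.toFun t * (γ.toFun t - q * z)⁻¹) := by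
    intro t ht
    have hv := γ.mem_trace ht
    have hvz : γ.toFun t - q * z ≠ 0 := fun e => hnot (sub_eq_zero.1 e ▸ hv)
    have hvo := div_mem_outside hq h hv
    have e : ∀ r ∈ Icc (0 : ℝ) 1, deriv γ.toFun t * deriv γ'.toFun r *
        ((γ.toFun t - q * γ'.toFun r)⁻¹ * (γ'.toFun r - z)⁻¹) =
        (deriv γ.toFun t * (γ.toFun t - q * z)⁻¹) * (deriv γ'.toFun r *
          ((γ'.toFun r - z)⁻¹ + (-1) * (γ'.toFun r - γ.toFun t / q)⁻¹)) := by
      intro r hr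
      have h1 := hne1 _ hv _ (γ'.mem_trace hr)
      have h2 := hne2 _ (γ'.mem_trace hr)
      have h3 : γ'.toFun r - γ.toFun t / q = -(γ.toFun t - q * γ'.toFun r) / q := by
        field_simp; ring
      rw [h3]
      field_simp
      ring
    rw [setIntegral_congr_fun measurableSet_Icc e, integral_const_mul]
    have h5 : cauchyIntegral γ' (fun w => (w - z)⁻¹ + (-1) * (w - γ.toFun t / q)⁻¹) = 1 := by
      rw [γ'.cauchyIntegral_add (g := fun w => (-1) * (w - γ.toFun t / q)⁻¹)
        (γ'.continuousOn_inv_sub hz.1)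
        (continuousOn_const.mul (γ'.continuousOn_inv_sub hvo.1)), cauchyIntegral_const_mul,
        cauchyIntegral_inv_sub, cauchyIntegral_inv_sub, hz.2, hvo.2]
      simp
    rw [cauchyIntegral, inv_mul_eq_iff_eq_mul₀ two_pi_I_ne_zero] at h5
    rw [h5]
    ring
  have hR : ∀ r ∈ Icc (0 : ℝ) 1, ∫ t in Icc (0 : ℝ) 1, deriv γ.toFun t * deriv γ'.toFun r *
      ((γ.toFun t - q * γ'.toFun r)⁻¹ * (γ'.toFun r - z)⁻¹) =
      2 * Real.pi * Complex.I * (deriv γ'.toFun r * (γ'.toFun r - z)⁻¹) := by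
    intro r hr
    have e : ∀ t : ℝ, deriv γ.toFun t * deriv γ'.toFun r *
        ((γ.toFun t - q * γ'.toFun r)⁻¹ * (γ'.toFun r - z)⁻¹) =
        (deriv γ'.toFun r * (γ'.toFun r - z)⁻¹) *
          (deriv γ.toFun t * (γ.toFun t - q * γ'.toFun r)⁻¹) := fun t => by ring
    simp only [e]
    rw [integral_const_mul]
    have h5 := γ.cauchyIntegral_inv_sub (q * γ'.toFun r)
    rw [(h _ (γ'.mem_trace hr)).2, cauchyIntegral,
      inv_mul_eq_iff_eq_mul₀ two_pi_I_ne_zero] at h5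
    rw [h5]
    ring
  rw [setIntegral_congr_fun measurableSet_Icc hL, setIntegral_congr_fun measurableSet_Icc hR,
    integral_const_mul, integral_const_mul] at hswap
  have h6 := mul_left_cancel₀ two_pi_I_ne_zero hswap
  rw [← γ.cauchyIntegral_inv_sub, cauchyIntegral, h6]
  rw [← hz.2, ← γ'.cauchyIntegral_inv_sub, cauchyIntegral]

end Contour

/-! ### Contour integrals of rational functions -/

namespace Contour

open Polynomial

variable (γ : Contour)

lemma cauchyIntegral_polynomial (P : ℂ[X]) : cauchyIntegral γ (fun x => P.eval x) = 0 := by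
  induction P using Polynomial.induction_on' with
  | add p q hp hq =>
    simp only [eval_add]
    rw [γ.cauchyIntegral_add p.continuousOn q.continuousOn, hp, hq, add_zero]
  | monomial n a =>
    refine γ.cauchyIntegral_eq_zero_of_hasDerivAt (g := fun x => a * (x ^ (n + 1) / (n + 1)))
      (fun z _ => ?_) (Polynomial.continuousOn _)
    have h := ((hasDerivAt_pow (n + 1) z).div_const ((n : ℂ) + 1)).const_mul a
    have hn : (n : ℂ) + 1 ≠ 0 := by exact_mod_cast n.succ_ne_zero
    convert! h using 1
    simp only [eval_monomial, Nat.add_sub_cancel, Nat.cast_add, Nat.cast_one]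
    field_simp

lemma prod_sub_ne_zero {s : Multiset ℂ} (hs : ∀ r ∈ s, r ∉ γ.trace) {x : ℂ} (hx : x ∈ γ.trace) :
    (s.map fun r => x - r).prod ≠ 0 := by
  refine Multiset.prod_ne_zero fun h => ?_
  obtain ⟨r, hr, e⟩ := Multiset.mem_map.1 h
  exact hs r hr (sub_eq_zero.1 e ▸ hx)

lemma continuousOn_inv_prod_sub {s : Multiset ℂ} (hs : ∀ r ∈ s, r ∉ γ.trace) :
    ContinuousOn (fun x => (s.map fun r => x - r).prod⁻¹) γ.trace :=
  ContinuousOn.inv₀ (Continuous.continuousOn (by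
    induction s using Multiset.induction_on with
    | empty => simpa using continuous_const
    | cons a s ih =>
      simp only [Multiset.map_cons, Multiset.prod_cons]
      exact (by fun_prop : Continuous fun x : ℂ => x - a).mul
        (ih fun r hr => hs r (Multiset.mem_cons_of_mem hr)))) fun _ hx => γ.prod_sub_ne_zero hs hx

/-- The integral of `1 / ∏ (x - r)` when the contour winds equally often around all the `r`.
If two of the `r` differ, a partial fraction step lowers their number; if they all agree, there is a
primitive as soon as there are at least two of them. -/
lemma cauchyIntegral_inv_prod_sub {w : ℂ} (s : Multiset ℂ)
    (hs : ∀ r ∈ s, r ∉ γ.trace ∧ windingNumber γ.toFun r = w) :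
    cauchyIntegral γ (fun x => (s.map fun r => x - r).prod⁻¹) =
      if Multiset.card s = 1 then w else 0 := by
  induction hn : Multiset.card s generalizing s with
  | zero =>
    obtain rfl := Multiset.card_eq_zero.1 hn
    simpa using γ.cauchyIntegral_polynomial 1
  | succ n ih =>
    obtain ⟨r, hr⟩ := Multiset.card_pos_iff_exists_mem.1 (by omega : 0 < Multiset.card s)
    by_cases hall : ∀ b ∈ s, b = r
    · rw [Multiset.eq_replicate_card.2 hall, hn]
      simp only [Multiset.map_replicate, Multiset.prod_replicate]
      by_cases hn0 : n = 0
      · subst hn0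
        simpa [(hs r hr).2] using γ.cauchyIntegral_inv_sub r
      · rw [if_neg (by omega)]
        have hne : ∀ z ∈ γ.trace, z - r ≠ 0 := fun z hz e =>
          (hs r hr).1 (sub_eq_zero.1 e ▸ hz)
        refine γ.cauchyIntegral_eq_zero_of_hasDerivAt
          (g := fun x => -((x - r) ^ n)⁻¹ / n) (fun z hz => ?_) ?_
        · have h := (((((hasDerivAt_id z).sub_const r).pow n).inv
            (pow_ne_zero n (hne z hz))).neg).div_const (n : ℂ)
          convert! h using 1
          have := hne z hz
          have hnc : (n : ℂ) ≠ 0 := by exact_mod_cast hn0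
          obtain ⟨m, rfl⟩ := Nat.exists_eq_succ_of_ne_zero hn0
          simp only [id, Nat.succ_eq_add_one, Nat.add_sub_cancel, Pi.pow_apply]
          field_simp
          ring
        · exact ContinuousOn.inv₀ (by fun_prop) fun z hz => pow_ne_zero _ (hne z hz)
    · push Not at hall
      obtain ⟨b, hb, hbr⟩ := hall
      obtain ⟨t, rfl⟩ := Multiset.exists_cons_of_mem hr
      have hbt : b ∈ t := by
        rcases Multiset.mem_cons.1 hb with h | h
        · exact absurd h hbr
        · exact h
      obtain ⟨t, rfl⟩ := Multiset.exists_cons_of_mem hbt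
      have h1 := ih (r ::ₘ t) (fun c hc => hs c (by
        rcases Multiset.mem_cons.1 hc with h | h
        · exact h ▸ hr
        · exact Multiset.mem_cons_of_mem (Multiset.mem_cons_of_mem h))) (by simpa using hn)
      have h2 := ih (b ::ₘ t) (fun c hc => hs c (Multiset.mem_cons_of_mem hc)) (by simpa using hn)
      have ht : ∀ c ∈ t, c ∉ γ.trace := fun c hc =>
        (hs c (Multiset.mem_cons_of_mem (Multiset.mem_cons_of_mem hc))).1
      have e : EqOn (fun x => (((r ::ₘ b ::ₘ t).map fun r => x - r).prod)⁻¹)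
          (fun x => (r - b)⁻¹ * ((((r ::ₘ t).map fun r => x - r).prod)⁻¹ +
            (-1) * (((b ::ₘ t).map fun r => x - r).prod)⁻¹)) γ.trace := by
        intro x hx
        have g1 : x - r ≠ 0 := fun e => (hs r hr).1 (sub_eq_zero.1 e ▸ hx)
        have g2 : x - b ≠ 0 := fun e => (hs b hb).1 (sub_eq_zero.1 e ▸ hx)
        have g3 := γ.prod_sub_ne_zero ht hx
        have g4 : r - b ≠ 0 := sub_ne_zero.2 (Ne.symm hbr)
        simp only [Multiset.map_cons, Multiset.prod_cons]
        field_simp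
        ring
      rw [γ.cauchyIntegral_congr e, cauchyIntegral_const_mul, cauchyIntegral_add
        (f := fun x => (((r ::ₘ t).map fun r => x - r).prod)⁻¹)
        (g := fun x => (-1) * (((b ::ₘ t).map fun r => x - r).prod)⁻¹), cauchyIntegral_const_mul,
        h1, h2]
      · rw [if_neg (show ¬n + 1 = 1 by simp only [Multiset.card_cons] at hn; omega)]
        ring
      · refine γ.continuousOn_inv_prod_sub fun c hc => ?_
        rcases Multiset.mem_cons.1 hc with h | h
        · exact h ▸ (hs r hr).1
        · exact ht c h
      · refine continuousOn_const.mul (γ.continuousOn_inv_prod_sub fun c hc => ?_)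
        exact (hs c (Multiset.mem_cons_of_mem hc)).1

/-- Dividing the numerator `P` by `X - r` for one root `r` at a time reduces this to constant
numerators. -/
lemma cauchyIntegral_div_prod_sub {w : ℂ} (s : Multiset ℂ)
    (hs : ∀ r ∈ s, r ∉ γ.trace ∧ windingNumber γ.toFun r = w) (P : ℂ[X])
    (hP : w = 0 ∨ P.natDegree + 2 ≤ Multiset.card s) :
    cauchyIntegral γ (fun x => P.eval x * (s.map fun r => x - r).prod⁻¹) = 0 := by
  induction s using Multiset.induction_on generalizing P with
  | empty => simpa using γ.cauchyIntegral_polynomial P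
  | cons r t ih =>
    have hr := hs r (Multiset.mem_cons_self r t)
    have ht : ∀ c ∈ t, c ∉ γ.trace ∧ windingNumber γ.toFun c = w := fun c hc =>
      hs c (Multiset.mem_cons_of_mem hc)
    have e : EqOn (fun x => P.eval x * (((r ::ₘ t).map fun r => x - r).prod)⁻¹)
        (fun x => P.eval r * (((r ::ₘ t).map fun r => x - r).prod)⁻¹ +
          (P /ₘ (X - C r)).eval x * ((t.map fun r => x - r).prod)⁻¹) γ.trace := by
      intro x hx
      have g1 : x - r ≠ 0 := fun e => hr.1 (sub_eq_zero.1 e ▸ hx)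
      have g3 := γ.prod_sub_ne_zero (fun c hc => (ht c hc).1) hx
      have h := congrArg (Polynomial.eval x) (modByMonic_add_div P (X - C r))
      rw [modByMonic_X_sub_C_eq_C_eval] at h
      simp only [eval_add, eval_C, eval_mul, eval_sub, eval_X] at h
      simp only [Multiset.map_cons, Multiset.prod_cons]
      rw [← h]
      field_simp
    have hc := γ.continuousOn_inv_prod_sub (s := r ::ₘ t) fun c hc => (hs c hc).1
    rw [γ.cauchyIntegral_congr e, cauchyIntegral_add, cauchyIntegral_const_mul,
      γ.cauchyIntegral_inv_prod_sub _ hs]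
    · have h1 : (if Multiset.card (r ::ₘ t) = 1 then w else 0) = 0 := by
        rcases hP with h | h
        · simp [h]
        · rw [if_neg (by omega)]
      rw [h1, mul_zero, zero_add]
      by_cases hd : P.natDegree = 0
      · have : P /ₘ (X - C r) = 0 := by
          rw [divByMonic_eq_zero_iff (monic_X_sub_C r), degree_X_sub_C]
          exact degree_le_natDegree.trans_lt (by simp [hd])
        rw [this]
        simpa using γ.cauchyIntegral_polynomial 0
      · refine ih ht _ (hP.imp id fun h => ?_)
        rw [natDegree_divByMonic _ (monic_X_sub_C r), natDegree_X_sub_C]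
        rw [Multiset.card_cons] at h
        omega
    · exact continuousOn_const.mul hc
    · exact (Polynomial.continuousOn _).mul (γ.continuousOn_inv_prod_sub fun c hc => (ht c hc).1)

/-- `f` agrees on `S` with a rational function of degree at most `d`, and `γ` winds `w` times
around each of the points where the denominator vanishes. On points of `S` that are zeros of the
denominator the value is the one that division by zero gives. -/
def RationalOn (w : ℂ) (d : ℤ) (S : Set ℂ) (f : ℂ → ℂ) : Prop :=
  ∃ P Q : ℂ[X], Q ≠ 0 ∧ (∀ r, Q.eval r = 0 → r ∉ γ.trace ∧ windingNumber γ.toFun r = w) ∧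
    (P.natDegree : ℤ) ≤ Q.natDegree + d ∧ ∀ x ∈ S, f x = P.eval x / Q.eval x

variable {γ}

namespace RationalOn

variable {w : ℂ} {d d' : ℤ} {S : Set ℂ} {f g : ℂ → ℂ}

lemma mul (hf : γ.RationalOn w d S f) (hg : γ.RationalOn w d' S g) :
    γ.RationalOn w (d + d') S (fun x => f x * g x) := by
  obtain ⟨P, Q, hQ, hr, hd, he⟩ := hf
  obtain ⟨P', Q', hQ', hr', hd', he'⟩ := hg
  refine ⟨P * P', Q * Q', mul_ne_zero hQ hQ', fun r h => ?_, ?_, fun x hx => ?_⟩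
  · rw [eval_mul] at h
    rcases mul_eq_zero.1 h with h | h
    · exact hr r h
    · exact hr' r h
  · rw [natDegree_mul hQ hQ']
    have := natDegree_mul_le (p := P) (q := P')
    push_cast
    omega
  · simp only [he x hx, he' x hx, eval_mul, div_mul_div_comm]

lemma const (c : ℂ) : γ.RationalOn w 0 S (fun _ => c) :=
  ⟨C c, 1, one_ne_zero, fun r h => by simp at h, by simp, fun x _ => by simp⟩

lemma pow (hf : γ.RationalOn w d S f) (n : ℕ) : γ.RationalOn w (n * d) S (fun x => f x ^ n) := by
  induction n with
  | zero => simpa using const 1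
  | succ n ih =>
    simp only [pow_succ]
    convert! ih.mul hf using 1
    push_cast
    ring

lemma prod {ι : Type*} (s : Finset ι) {F : ι → ℂ → ℂ} {e : ι → ℤ}
    (h : ∀ i ∈ s, γ.RationalOn w (e i) S (F i)) :
    γ.RationalOn w (∑ i ∈ s, e i) S (fun x => ∏ i ∈ s, F i x) := by
  classical
  induction s using Finset.induction_on with
  | empty => simpa using const 1
  | insert a s ha ih =>
    simp only [Finset.prod_insert ha, Finset.sum_insert ha]
    exact (h a (Finset.mem_insert_self a s)).mul
      (ih fun i hi => h i (Finset.mem_insert_of_mem hi))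

lemma congr (hf : γ.RationalOn w d S f) (h : ∀ x ∈ S, g x = f x) : γ.RationalOn w d S g := by
  obtain ⟨P, Q, hQ, hr, hd, he⟩ := hf
  exact ⟨P, Q, hQ, hr, hd, fun x hx => (h x hx).trans (he x hx)⟩

/-- Quotients of linear functions. -/
lemma linear_div_linear (a b c e : ℂ) (hc : c ≠ 0)
    (hr : -e / c ∉ γ.trace ∧ windingNumber γ.toFun (-e / c) = w) :
    γ.RationalOn w 0 S (fun x => (a * x + b) / (c * x + e)) := by
  refine ⟨C a * X + C b, C c * X + C e, fun h => ?_, fun r h => ?_, ?_, fun x _ => by simp⟩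
  · have := natDegree_linear (b := e) hc
    rw [h] at this
    simp at this
  · simp only [eval_add, eval_mul, eval_C, eval_X] at h
    have : r = -e / c := by rw [eq_div_iff hc]; linear_combination h
    exact this ▸ hr
  · rw [natDegree_linear hc]
    have := natDegree_linear_le (a := a) (b := b)
    omega

lemma inv_linear (c e : ℂ) (hc : c ≠ 0)
    (hr : -e / c ∉ γ.trace ∧ windingNumber γ.toFun (-e / c) = w) :
    γ.RationalOn w (-1) S (fun x => 1 / (c * x + e)) := by
  refine ⟨1, C c * X + C e, fun h => ?_, fun r h => ?_, ?_, fun x _ => by simp⟩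
  · have := natDegree_linear (b := e) hc
    rw [h] at this
    simp at this
  · simp only [eval_add, eval_mul, eval_C, eval_X] at h
    have : r = -e / c := by rw [eq_div_iff hc]; linear_combination h
    exact this ▸ hr
  · rw [natDegree_linear hc]
    simp

/-- A rational function has zero integral if no pole lies inside the contour, and also if all poles
lie inside the contour and it decays at least like `x⁻²`. -/
lemma cauchyIntegral_eq_zero (hf : γ.RationalOn w d γ.trace f) (h : w = 0 ∨ d ≤ -2) :
    cauchyIntegral γ f = 0 := by
  obtain ⟨P, Q, hQ, hr, hd, he⟩ := hf
  have hs := IsAlgClosed.splits Q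
  have hcard := hs.natDegree_eq_card_roots
  have e : EqOn f (fun x => Q.leadingCoeff⁻¹ *
      (P.eval x * (Q.roots.map fun r => x - r).prod⁻¹)) γ.trace := by
    intro x hx
    rw [he x hx]
    have := congrArg (Polynomial.eval x) hs.eq_prod_roots
    rw [eval_mul, eval_C, eval_multiset_prod, Multiset.map_map] at this
    simp only [Function.comp_def, eval_sub, eval_X, eval_C] at this
    rw [this]
    simp only [div_eq_mul_inv, mul_inv]
    ring
  rw [γ.cauchyIntegral_congr e, cauchyIntegral_const_mul, cauchyIntegral_div_prod_sub (w := w),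
    mul_zero]
  · exact fun r hrr => hr r ((mem_roots hQ).1 hrr)
  · refine h.imp id fun h => ?_
    rw [← hcard]
    omega

/-- The residue formula for a rational function with a single simple pole inside the contour. -/
lemma cauchyIntegral_inv_sub_mul {a : ℂ} (ha : a ∈ γ.inside) (hf : γ.RationalOn 0 d univ f) :
    cauchyIntegral γ (fun x => (x - a)⁻¹ * f x) = f a := by
  obtain ⟨P, Q, hQ, hr, hd, he⟩ := hf
  have hQx : ∀ x ∈ γ.trace, Q.eval x ≠ 0 := fun x hx h => (hr x h).1 hx
  have hQa : Q.eval a ≠ 0 := fun h => by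
    have := (hr a h).2
    rw [ha.2] at this
    exact one_ne_zero this
  have hdvd : (X - C a) ∣ P - C (P.eval a / Q.eval a) * Q := by
    rw [dvd_iff_isRoot, IsRoot, eval_sub, eval_mul, eval_C, div_mul_cancel₀ _ hQa, sub_self]
  obtain ⟨R, hR⟩ := hdvd
  have e : EqOn (fun x => (x - a)⁻¹ * f x)
      (fun x => (P.eval a / Q.eval a) * (x - a)⁻¹ + R.eval x / Q.eval x) γ.trace := by
    intro x hx
    have g1 : x - a ≠ 0 := fun e => ha.1 (sub_eq_zero.1 e ▸ hx)
    have g2 := hQx x hx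
    have h := congrArg (Polynomial.eval x) hR
    simp only [eval_sub, eval_mul, eval_C, eval_X] at h
    have h' : P.eval x = P.eval a / Q.eval a * Q.eval x + (x - a) * R.eval x := by
      linear_combination h
    simp only [he x (mem_univ x), h']
    field_simp
  have hzero : cauchyIntegral γ (fun x => R.eval x / Q.eval x) = 0 :=
    RationalOn.cauchyIntegral_eq_zero (w := 0) (d := R.natDegree)
      ⟨R, Q, hQ, hr, by simp, fun _ _ => rfl⟩ (Or.inl rfl)
  rw [γ.cauchyIntegral_congr e, cauchyIntegral_add, cauchyIntegral_const_mul,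
    cauchyIntegral_inv_sub, hzero, ha.2, he a (mem_univ a)]
  · ring
  · exact continuousOn_const.mul (γ.continuousOn_inv_sub ha.1)
  · exact R.continuousOn.div Q.continuousOn hQx

end RationalOn

end Contour

/-! ### Iterated contour integrals -/

variable {k : ℕ}

lemma volume_restrict_Icc :
    (volume : Measure (Fin k → ℝ)).restrict (Icc 0 1) =
      Measure.pi fun _ => volume.restrict (Icc (0 : ℝ) 1) := by
  rw [← Measure.restrict_pi_pi, ← volume_pi, pi_univ_Icc]
  rfl

lemma contourIntegrable_of_continuousOn {γ : Fin k → Contour} {f : (Fin k → ℂ) → ℂ}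
    (hf : ContinuousOn f (univ.pi fun i => (γ i).trace)) : ContourIntegrable γ f := by
  unfold ContourIntegrable IntegrableOn pullback
  have hmem : ∀ t ∈ Icc (0 : Fin k → ℝ) 1, ∀ i, t i ∈ Icc (0 : ℝ) 1 := fun t ht i =>
    ⟨ht.1 i, ht.2 i⟩
  have hc : ContinuousOn (fun t : Fin k → ℝ => f fun i => (γ i).toFun (t i)) (Icc 0 1) := by
    refine hf.comp (continuousOn_pi.2 fun i => ?_) fun t ht i _ => (γ i).mem_trace (hmem t ht i)
    exact (γ i).continuousOn.comp (continuous_apply i).continuousOn fun t ht => hmem t ht i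
  obtain ⟨C, hC⟩ := isCompact_Icc.exists_bound_of_continuousOn hc
  refine Integrable.mul_bdd (c := C) ?_ (hc.aestronglyMeasurable measurableSet_Icc)
    ((ae_restrict_iff' measurableSet_Icc).2 (Filter.Eventually.of_forall hC))
  rw [volume_restrict_Icc]
  exact Integrable.fintype_prod fun i => (γ i).integrable_deriv

/-- Fubini: one of the variables can be integrated out before the others. -/
lemma contourIntegral_succAbove (c : Fin (k + 1)) {γ : Fin (k + 1) → Contour}
    {f : (Fin (k + 1) → ℂ) → ℂ} (hf : ContourIntegrable γ f) :
    contourIntegral γ f = contourIntegral (fun i => γ (c.succAbove i))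
      (fun u => cauchyIntegral (γ c) fun x => f (c.insertNth x u)) := by
  unfold ContourIntegrable IntegrableOn at hf
  unfold contourIntegral
  rw [volume_restrict_Icc] at hf ⊢
  rw [volume_restrict_Icc]
  have hmp := (measurePreserving_piFinSuccAbove
    (fun _ : Fin (k + 1) => volume.restrict (Icc (0 : ℝ) 1)) c).symm
  rw [← hmp.integral_comp (MeasurableEquiv.measurableEmbedding _)]
  rw [← hmp.integrable_comp_emb (MeasurableEquiv.measurableEmbedding _)] at hf
  rw [Function.comp_def] at hf
  rw [integral_prod_symm _ hf]
  have e : ∀ (t : Fin k → ℝ), (∫ x in Icc (0 : ℝ) 1, pullback γ f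
      ((MeasurableEquiv.piFinSuccAbove (fun _ => ℝ) c).symm (x, t))) =
      (2 * Real.pi * Complex.I) * pullback (fun i => γ (c.succAbove i))
      (fun u => cauchyIntegral (γ c) fun x => f (c.insertNth x u)) t := by
    intro t
    have e1 : ∀ x : ℝ, pullback γ f ((MeasurableEquiv.piFinSuccAbove (fun _ => ℝ) c).symm (x, t)) =
        (∏ i, deriv (γ (c.succAbove i)).toFun (t i)) * (deriv (γ c).toFun x *
          f (c.insertNth ((γ c).toFun x) fun i => (γ (c.succAbove i)).toFun (t i))) := by
      intro x
      simp only [pullback, MeasurableEquiv.piFinSuccAbove_symm_apply, Fin.insertNthEquiv_apply]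
      rw [Fin.prod_univ_succAbove _ c]
      simp only [Fin.insertNth_apply_same, Fin.insertNth_apply_succAbove]
      have : (fun i => (γ i).toFun (c.insertNth (α := fun _ => ℝ) x t i)) =
          c.insertNth (α := fun _ => ℂ) ((γ c).toFun x)
            fun i => (γ (c.succAbove i)).toFun (t i) := by
        funext i
        refine c.succAboveCases ?_ (fun j => ?_) i <;> simp
      rw [this]
      ring
    simp only [e1]
    rw [integral_const_mul]
    simp only [pullback, cauchyIntegral]
    field_simp [two_pi_I_ne_zero]
  simp only [e]
  rw [integral_const_mul, pow_succ, mul_inv]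
  have := two_pi_I_ne_zero
  field_simp

lemma contourIntegral_congr {γ : Fin k → Contour} {f g : (Fin k → ℂ) → ℂ}
    (h : ∀ u, (∀ i, u i ∈ (γ i).trace) → f u = g u) : contourIntegral γ f = contourIntegral γ g := by
  unfold contourIntegral
  congr 1
  refine setIntegral_congr_fun measurableSet_Icc fun t ht => ?_
  simp only [pullback]
  rw [h _ fun i => (γ i).mem_trace ⟨ht.1 i, ht.2 i⟩]

lemma ContourIntegrable.congr {γ : Fin k → Contour} {f g : (Fin k → ℂ) → ℂ}
    (hf : ContourIntegrable γ f)
    (h : ∀ u, (∀ i, u i ∈ (γ i).trace) → f u = g u) : ContourIntegrable γ g := by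
  refine IntegrableOn.congr_fun hf (fun t ht => ?_) measurableSet_Icc
  simp only [pullback]
  rw [h _ fun i => (γ i).mem_trace ⟨ht.1 i, ht.2 i⟩]

lemma contourIntegral_const_mul (γ : Fin k → Contour) (c : ℂ) (f : (Fin k → ℂ) → ℂ) :
    contourIntegral γ (fun u => c * f u) = c * contourIntegral γ f := by
  simp only [contourIntegral, pullback, mul_left_comm _ c]
  rw [integral_const_mul, mul_left_comm]

lemma contourIntegral_sum {ι : Type*} (s : Finset ι) {γ : Fin k → Contour}
    {f : ι → (Fin k → ℂ) → ℂ} (hf : ∀ i ∈ s, ContourIntegrable γ (f i)) :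
    contourIntegral γ (fun u => ∑ i ∈ s, f i u) = ∑ i ∈ s, contourIntegral γ (f i) := by
  have : pullback γ (fun u => ∑ i ∈ s, f i u) = fun t => ∑ i ∈ s, pullback γ (f i) t := by
    funext t
    simp only [pullback, Finset.mul_sum]
  simp only [contourIntegral, this]
  rw [integral_finsetSum _ hf, Finset.mul_sum]

lemma ContourIntegrable.sum {ι : Type*} (s : Finset ι) {γ : Fin k → Contour}
    {f : ι → (Fin k → ℂ) → ℂ} (hf : ∀ i ∈ s, ContourIntegrable γ (f i)) :
    ContourIntegrable γ (fun u => ∑ i ∈ s, f i u) := by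
  have : pullback γ (fun u => ∑ i ∈ s, f i u) = fun t => ∑ i ∈ s, pullback γ (f i) t := by
    funext t
    simp only [pullback, Finset.mul_sum]
  unfold ContourIntegrable
  rw [this]
  exact integrable_finsetSum _ hf

/-- An iterated integral vanishes if the integral over one of the variables does. -/
lemma contourIntegral_eq_zero_of_update (c : Fin k) {γ : Fin k → Contour}
    {f : (Fin k → ℂ) → ℂ} (hf : ContourIntegrable γ f)
    (h : ∀ u, (∀ i, i ≠ c → u i ∈ (γ i).trace) →
      cauchyIntegral (γ c) (fun x => f (Function.update u c x)) = 0) :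
    contourIntegral γ f = 0 := by
  obtain _ | k := k
  · exact c.elim0
  rw [contourIntegral_succAbove c hf, contourIntegral_congr (g := fun _ => 0)]
  · simpa using contourIntegral_const_mul (fun i => γ (c.succAbove i)) 0 (fun _ => 0)
  · intro u hu
    have := h (c.insertNth 0 u) fun i hi => by
      obtain ⟨j, rfl⟩ := Fin.exists_succAbove_eq hi
      simpa using hu j
    simpa only [Fin.update_insertNth] using this

/-- A contour integral with the same contour for all variables is invariant under permutations of
the variables. -/
lemma contourIntegral_comp_perm (γ : Contour) (τ : Equiv.Perm (Fin k)) (f : (Fin k → ℂ) → ℂ) :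
    contourIntegral (fun _ => γ) (fun u => f (u ∘ τ)) = contourIntegral (fun _ => γ) f := by
  unfold contourIntegral
  congr 1
  rw [volume_restrict_Icc]
  have hmp := measurePreserving_piCongrLeft
    (fun _ : Fin k => volume.restrict (Icc (0 : ℝ) 1)) τ.symm
  rw [← hmp.integral_comp (MeasurableEquiv.measurableEmbedding _) (pullback _ f)]
  refine integral_congr_ae (Filter.Eventually.of_forall fun t => ?_)
  have e : ∀ i, MeasurableEquiv.piCongrLeft (fun _ : Fin k => ℝ) τ.symm t i = t (τ i) := fun i => by
    have := MeasurableEquiv.piCongrLeft_apply_apply (β := fun _ : Fin k => ℝ) (e := τ.symm)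
      (x := t) (i := τ i)
    simpa using this
  simp only [pullback, e]
  rw [Equiv.prod_comp τ fun i => deriv γ.toFun (t i)]
  rfl

/-! ### Symmetrization identities -/

/-- The number of indices after `a` with the same label as `a`. -/
def laterEqual {k : ℕ} (l : Fin k → ℕ) (a : Fin k) : ℕ :=
  ((Finset.Ioi a).filter fun b => l b = l a).card

/-- The sum is evaluated by applying Lagrange interpolation at the nodes `0` and `u j` to
`∏ b ∈ s, (X - q u_b)`, whose leading coefficient is `1`. -/
lemma sum_prod_div_sub {ι : Type*} [DecidableEq ι] (q : ℂ) (s : Finset ι) (u : ι → ℂ)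
    (hinj : InjOn u s) (h0 : ∀ j ∈ s, u j ≠ 0) :
    (1 - q) * ∑ j ∈ s, ∏ b ∈ s.erase j, (u j - q * u b) / (u j - u b) = 1 - q ^ s.card := by
  classical
  let v : Option ι → ℂ := fun o => o.elim 0 u
  let P : Polynomial ℂ := ∏ b ∈ s, (Polynomial.X - Polynomial.C (q * u b))
  have hvs : InjOn v (Finset.insertNone s : Finset (Option ι)) := by
    rintro (_ | a) ha (_ | b) hb hab
    · rfl
    · exact absurd hab.symm (h0 b (by simpa using hb))
    · exact absurd hab (h0 a (by simpa using ha))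
    · exact congrArg some (hinj (by simpa using ha) (by simpa using hb) hab)
  have hP : ((Finset.insertNone s).card : WithBot ℕ) = P.degree + 1 := by
    simp [P, Polynomial.degree_prod, -map_mul]
  have key := Lagrange.leadingCoeff_eq_sum hvs hP
  have hmon : P.Monic := Polynomial.monic_prod_of_monic _ _ fun i _ => Polynomial.monic_X_sub_C _
  have hev : ∀ x, P.eval x = ∏ b ∈ s, (x - q * u b) := fun x => by
    simp [P, Polynomial.eval_prod]
  have e1 : (Finset.insertNone s).erase none = s.map Function.Embedding.some := by
    ext (_ | x) <;> simp
  have e2 : ∀ j, (Finset.insertNone s).erase (some j) = Finset.insertNone (s.erase j) := by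
    intro j
    ext (_ | x) <;> simp
  rw [hmon.leadingCoeff, Finset.sum_insertNone, e1, Finset.prod_map] at key
  simp only [e2, hev, Finset.prod_insertNone] at key
  simp only [v, Option.elim, Function.Embedding.some_apply, zero_sub, sub_zero] at key
  have t0 : (∏ x ∈ s, -(q * u x)) / ∏ x ∈ s, -u x = q ^ s.card := by
    rw [← Finset.prod_div_distrib, ← Finset.prod_const]
    refine Finset.prod_congr rfl fun x hx => ?_
    have := h0 x hx
    field_simp
  have t1 : ∀ j ∈ s, (∏ x ∈ s, (u j - q * u x)) / (u j * ∏ x ∈ s.erase j, (u j - u x)) =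
      (1 - q) * ∏ b ∈ s.erase j, (u j - q * u b) / (u j - u b) := by
    intro j hj
    rw [← Finset.mul_prod_erase s _ hj, Finset.prod_div_distrib]
    have := h0 j hj
    have hne : ∏ x ∈ s.erase j, (u j - u x) ≠ 0 := Finset.prod_ne_zero_iff.2 fun x hx e => by
      rw [Finset.mem_erase] at hx
      exact hx.1 (hinj hx.2 hj (sub_eq_zero.1 e).symm)
    field_simp
  rw [t0, Finset.sum_congr rfl t1, ← Finset.mul_sum] at key
  linear_combination -key

/-- The generic form of the symmetrization identity, with interactions only between equal labels and
a sum over label-preserving permutations. Summing over the image `j` of `0` splits off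
`sum_prod_div_sub` for the block of `0`; the remaining sum has the same form, and its value does not
depend on `j`. -/
lemma sum_perm_prod_div {n : ℕ} (q : ℂ) (hq : q ≠ 1) (l : Fin n → ℕ) (u : Fin n → ℂ)
    (hinj : Function.Injective u) (h0 : ∀ j, u j ≠ 0) :
    (∑ σ : Equiv.Perm (Fin n), if ∀ i, l (σ i) = l i then
      ∏ a, ∏ b ∈ Finset.Ioi a,
        (if l b = l a then (u (σ a) - q * u (σ b)) / (u (σ a) - u (σ b)) else 1) else 0) =
      ∏ a, (1 - q ^ (laterEqual l a + 1)) / (1 - q) := by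
  have hq1 : 1 - q ≠ 0 := sub_ne_zero.2 hq.symm
  induction n with
  | zero => simp
  | succ n ih =>
    rw [← Equiv.sum_comp Equiv.Perm.decomposeFin.symm, Fintype.sum_prod_type]
    set B : Finset (Fin (n + 1)) := Finset.univ.filter fun b => l b = l 0 with hB
    set C : ℂ := ∏ a : Fin n, (1 - q ^ (laterEqual (fun i => l (Fin.succ i)) a + 1)) / (1 - q)
      with hC
    have hswap : ∀ j, l j = l 0 → ∀ y, l (Equiv.swap 0 j y) = l y := by
      intro j hj y
      rw [Equiv.swap_apply_def]
      split_ifs with h1 h2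
      · rw [h1, hj]
      · rw [h2, hj]
      · rfl
    have hterm : ∀ j : Fin (n + 1), (∑ e : Equiv.Perm (Fin n),
        if ∀ i, l (Equiv.Perm.decomposeFin.symm (j, e) i) = l i then
          ∏ a, ∏ b ∈ Finset.Ioi a, (if l b = l a then
            (u (Equiv.Perm.decomposeFin.symm (j, e) a) -
              q * u (Equiv.Perm.decomposeFin.symm (j, e) b)) /
            (u (Equiv.Perm.decomposeFin.symm (j, e) a) -
              u (Equiv.Perm.decomposeFin.symm (j, e) b)) else 1) else 0) =
        if l j = l 0 then (∏ b ∈ B.erase j, (u j - q * u b) / (u j - u b)) * C else 0 := by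
      intro j
      split_ifs with hj
      · rw [hC, ← ih (fun i => l i.succ) (fun i => u (Equiv.swap 0 j i.succ))
          (fun a b h => Fin.succ_injective _ ((Equiv.swap 0 j).injective (hinj h)))
          (fun i => h0 _), Finset.mul_sum]
        refine Finset.sum_congr rfl fun e _ => ?_
        have hiff : (∀ i, l (Equiv.Perm.decomposeFin.symm (j, e) i) = l i) ↔
            ∀ i, l (e i).succ = l (Fin.succ i) := by
          rw [Fin.forall_fin_succ]
          simp [hj, hswap j hj]
        rw [mul_ite, mul_zero]
        by_cases hl : ∀ i, l (e i).succ = l (Fin.succ i)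
        · rw [if_pos (hiff.2 hl), if_pos hl, Fin.prod_univ_succ]
          simp only [Fin.prod_Ioi_zero, Fin.prod_Ioi_succ, Equiv.Perm.decomposeFin_symm_apply_zero,
            Equiv.Perm.decomposeFin_symm_apply_succ]
          congr 1
          have e1 : ∏ x : Fin n, (if l x.succ = l 0 then
              (u j - q * u (Equiv.swap 0 j (e x).succ)) / (u j - u (Equiv.swap 0 j (e x).succ))
              else 1) = ∏ x : Fin n, (if l x.succ = l 0 then
              (u j - q * u (Equiv.swap 0 j x.succ)) / (u j - u (Equiv.swap 0 j x.succ))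
              else 1) := by
            refine Eq.trans ?_ (Equiv.prod_comp e fun x : Fin n => if l x.succ = l 0 then
              (u j - q * u (Equiv.swap 0 j x.succ)) / (u j - u (Equiv.swap 0 j x.succ)) else 1)
            simp only [hl]
          have e2 : B.erase j = ((Finset.univ.filter fun x : Fin n => l x.succ = l 0).map
              (Fin.succEmb n)).map (Equiv.swap 0 j).toEmbedding := by
            ext b
            simp only [hB, Finset.mem_erase, Finset.mem_filter, Finset.mem_univ, true_and,
              Finset.mem_map, Fin.coe_succEmb,
              Equiv.coe_toEmbedding]
            constructor
            · rintro ⟨h1, h2⟩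
              have h3 : Equiv.swap 0 j b ≠ 0 := fun h => h1 (by
                have := congrArg (Equiv.swap 0 j) h
                simpa using this)
              obtain ⟨x, hx⟩ := Fin.exists_succ_eq.2 h3
              exact ⟨x.succ, ⟨x, by rw [hx, hswap j hj, h2], rfl⟩, by rw [hx, Equiv.swap_apply_self]⟩
            · rintro ⟨_, ⟨x, hx1, rfl⟩, rfl⟩
              refine ⟨fun h => Fin.succ_ne_zero x ?_, by rw [hswap j hj, hx1]⟩
              rw [Equiv.swap_apply_eq_iff, Equiv.swap_apply_right] at h
              exact h
          rw [e1, e2, Finset.prod_map, Finset.prod_map, Finset.prod_filter]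
          rfl
        · rw [if_neg (fun h => hl (hiff.1 h)), if_neg hl]
      · refine Finset.sum_eq_zero fun e _ => if_neg fun h => hj ?_
        simpa using h 0
    rw [Finset.sum_congr rfl fun j _ => hterm j, ← Finset.sum_filter, ← Finset.sum_mul,
      Fin.prod_univ_succ]
    have hlat0 : laterEqual l 0 + 1 = B.card := by
      have : B = insert 0 ((Finset.Ioi 0).filter fun b => l b = l 0) := by
        ext b
        simp only [hB, Finset.mem_filter, Finset.mem_univ, true_and, Finset.mem_insert,
          Finset.mem_Ioi]
        rcases Fin.eq_zero_or_eq_succ b with rfl | ⟨x, rfl⟩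
        · simp
        · simp [Fin.succ_pos]
      rw [this, Finset.card_insert_of_notMem (by simp), laterEqual]
    have hlat : ∀ a : Fin n, laterEqual l a.succ = laterEqual (fun i => l (Fin.succ i)) a := by
      intro a
      simp only [laterEqual, Finset.card_filter, Fin.sum_Ioi_succ]
    simp only [hlat0, hlat, hC]
    congr 1
    rw [eq_div_iff hq1, mul_comm]
    exact sum_prod_div_sub q B u hinj.injOn fun j _ => h0 j

@[to_additive]
lemma prod_Ioi_eq_prod_ite {M : Type*} [CommMonoid M] (f : Fin k → M) (a : Fin k) :
    ∏ b ∈ Finset.Ioi a, f b = ∏ b, if a < b then f b else 1 := by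
  rw [← Finset.prod_filter]
  congr 1
  ext b
  simp

/-- A product over pairs with distinct labels is invariant under label-preserving permutations. -/
lemma prod_distinct_labels_comp_perm {l : Fin k → ℕ} (hl : Antitone l) {σ : Equiv.Perm (Fin k)}
    (hσ : ∀ i, l (σ i) = l i) (f : Fin k → Fin k → ℂ) :
    ∏ a, ∏ b ∈ Finset.Ioi a, (if l b = l a then 1 else f (σ a) (σ b)) =
      ∏ a, ∏ b ∈ Finset.Ioi a, (if l b = l a then 1 else f a b) := by
  have h : ∀ g : Fin k → Fin k → ℂ,
      ∏ a, ∏ b ∈ Finset.Ioi a, (if l b = l a then 1 else g a b) =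
        ∏ a, ∏ b, if l b < l a then g a b else 1 := by
    intro g
    refine Finset.prod_congr rfl fun a _ => ?_
    rw [prod_Ioi_eq_prod_ite]
    refine Finset.prod_congr rfl fun b _ => ?_
    by_cases hab : a < b
    · have := hl hab.le
      rcases this.lt_or_eq with h1 | h1
      · simp [hab, h1, h1.ne]
      · simp [hab, h1]
    · have := hl (not_lt.1 hab)
      simp [hab, not_lt.2 this]
  rw [h, h]
  refine Eq.trans ?_ (Equiv.prod_comp σ fun a => ∏ b, if l b < l a then f a b else 1)
  refine Finset.prod_congr rfl fun a _ => ?_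
  refine Eq.trans ?_ (Equiv.prod_comp σ fun b => if l b < l (σ a) then f (σ a) b else 1)
  simp only [hσ]

lemma prod_sub_ne_zero_of_injective {u : Fin k → ℂ} (hu : Function.Injective u) :
    ∏ a, ∏ b ∈ Finset.Ioi a, (u a - u b) ≠ 0 := by
  refine Finset.prod_ne_zero_iff.2 fun a _ => Finset.prod_ne_zero_iff.2 fun b hb e => ?_
  exact (Finset.mem_Ioi.1 hb).ne (hu (sub_eq_zero.1 e))

lemma prod_sub_comp_perm (σ : Equiv.Perm (Fin k)) (u : Fin k → ℂ) :
    ∏ a, ∏ b ∈ Finset.Ioi a, (u (σ a) - u (σ b)) =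
      (Equiv.Perm.sign σ : ℂ) * ∏ a, ∏ b ∈ Finset.Ioi a, (u a - u b) :=
  σ.prod_Ioi_comp_eq_sign_mul_prod (f := fun a b => u a - u b) fun i j => by ring

lemma sign_mul_self (σ : Equiv.Perm (Fin k)) :
    ((Equiv.Perm.sign σ : ℤ) : ℂ) * ((Equiv.Perm.sign σ : ℤ) : ℂ) = 1 := by
  rcases Int.units_eq_one_or (Equiv.Perm.sign σ) with h | h <;> simp [h]

lemma prod_div_sub_mul_prod_sub {u : Fin k → ℂ} (hu : Function.Injective u) (q : ℂ)
    (σ : Equiv.Perm (Fin k)) :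
    (∏ a, ∏ b ∈ Finset.Ioi a, (u a - u b)) *
      ∏ a, ∏ b ∈ Finset.Ioi a, (u (σ a) - q * u (σ b)) / (u (σ a) - u (σ b)) =
      (Equiv.Perm.sign σ : ℂ) * ∏ a, ∏ b ∈ Finset.Ioi a, (u (σ a) - q * u (σ b)) := by
  simp only [Finset.prod_div_distrib]
  rw [prod_sub_comp_perm]
  have h1 := prod_sub_ne_zero_of_injective hu
  have h2 := sign_mul_self σ
  have h3 : ((Equiv.Perm.sign σ : ℤ) : ℂ) ≠ 0 := left_ne_zero_of_mul_eq_one h2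
  field_simp
  linear_combination (-∏ a, ∏ b ∈ Finset.Ioi a, (u (σ a) - q * u (σ b))) * h2

/-- Symmetrization over the permutations that preserve the labels `l`. Both sides are polynomials
in `u`, so it is enough to treat the generic case of distinct nonzero `u i`. -/
lemma sum_sign_mul_prod_sub {q : ℂ} (hq : q ≠ 1) {l : Fin k → ℕ} (hl : Antitone l)
    (u : Fin k → ℂ) :
    (∑ σ : Equiv.Perm (Fin k), if ∀ i, l (σ i) = l i then
      (Equiv.Perm.sign σ : ℂ) * ∏ a, ∏ b ∈ Finset.Ioi a, (u (σ a) - q * u (σ b)) else 0) =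
      (∏ a, (1 - q ^ (laterEqual l a + 1)) / (1 - q)) *
        ∏ a, ∏ b ∈ Finset.Ioi a, (if l b = l a then u a - u b else u a - q * u b) := by
  have hgen : ∀ u : Fin k → ℂ, Function.Injective u → (∀ i, u i ≠ 0) →
      (∑ σ : Equiv.Perm (Fin k), if ∀ i, l (σ i) = l i then
      (Equiv.Perm.sign σ : ℂ) * ∏ a, ∏ b ∈ Finset.Ioi a, (u (σ a) - q * u (σ b)) else 0) =
      (∏ a, (1 - q ^ (laterEqual l a + 1)) / (1 - q)) *
        ∏ a, ∏ b ∈ Finset.Ioi a, (if l b = l a then u a - u b else u a - q * u b) := by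
    intro u hu h0
    rw [← sum_perm_prod_div q hq l u hu h0, Finset.sum_mul]
    refine Finset.sum_congr rfl fun σ _ => ?_
    split_ifs with hσ
    · rw [← prod_div_sub_mul_prod_sub hu]
      have hsplit : ∏ a, ∏ b ∈ Finset.Ioi a, (u (σ a) - q * u (σ b)) / (u (σ a) - u (σ b)) =
          (∏ a, ∏ b ∈ Finset.Ioi a, (if l b = l a then
            (u (σ a) - q * u (σ b)) / (u (σ a) - u (σ b)) else 1)) *
          ∏ a, ∏ b ∈ Finset.Ioi a, (if l b = l a then 1 else
            (u (σ a) - q * u (σ b)) / (u (σ a) - u (σ b))) := by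
        simp only [← Finset.prod_mul_distrib]
        refine Finset.prod_congr rfl fun a _ => Finset.prod_congr rfl fun b _ => ?_
        split_ifs <;> simp
      rw [hsplit, prod_distinct_labels_comp_perm hl hσ
        (fun a b => (u a - q * u b) / (u a - u b)), mul_left_comm]
      congr 1
      simp only [← Finset.prod_mul_distrib]
      refine Finset.prod_congr rfl fun a _ => Finset.prod_congr rfl fun b hb => ?_
      have : u a - u b ≠ 0 := fun e => (Finset.mem_Ioi.1 hb).ne (hu (sub_eq_zero.1 e))
      split_ifs
      · rw [mul_one]
      · field_simp
    · rw [zero_mul]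
  -- perturb `u` to `u i + t (i + 1)` with a small `t ≠ 0`
  let v : ℂ → Fin k → ℂ := fun t i => u i + t * ((i : ℕ) + 1)
  have hcond : ∀ᶠ t in nhdsWithin (0 : ℂ) {0}ᶜ, Function.Injective (v t) ∧ ∀ i, v t i ≠ 0 := by
    have key : ∀ c d : ℂ, d ≠ 0 → ∀ᶠ t in nhdsWithin (0 : ℂ) {0}ᶜ, c + t * d ≠ 0 := by
      intro c d hd
      by_cases hc : c = 0
      · filter_upwards [self_mem_nhdsWithin] with t ht
        simpa [hc, hd] using ht
      · refine Filter.Eventually.filter_mono nhdsWithin_le_nhds ?_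
        have : ContinuousAt (fun t : ℂ => c + t * d) 0 := by fun_prop
        exact this.eventually_ne (by simpa using hc)
    have h1 : ∀ i j : Fin k, i ≠ j → ∀ᶠ t in nhdsWithin (0 : ℂ) {0}ᶜ, v t i ≠ v t j := by
      intro i j hij
      have hd : ((i : ℕ) : ℂ) - (j : ℕ) ≠ 0 :=
        sub_ne_zero.2 fun e => hij (Fin.ext (by exact_mod_cast e))
      filter_upwards [key (u i - u j) _ hd] with t ht e
      exact ht (by simp only [v] at e; linear_combination e)
    have h2 : ∀ i : Fin k, ∀ᶠ t in nhdsWithin (0 : ℂ) {0}ᶜ, v t i ≠ 0 := fun i =>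
      key (u i) _ (by exact_mod_cast (i : ℕ).succ_ne_zero)
    have h1' : ∀ᶠ t in nhdsWithin (0 : ℂ) {0}ᶜ, ∀ i j, i ≠ j → v t i ≠ v t j := by
      simp only [Filter.eventually_all]
      exact h1
    filter_upwards [h1', Filter.eventually_all.2 h2] with t ht1 ht2
    exact ⟨fun i j h => by_contra fun hij => ht1 i j hij h, ht2⟩
  have hv0 : v 0 = u := by funext i; simp [v]
  have hvc : ∀ i, Continuous fun t => v t i := fun i => by simp only [v]; fun_prop
  have hL : Continuous fun t => ∑ σ : Equiv.Perm (Fin k), if ∀ i, l (σ i) = l i then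
      (Equiv.Perm.sign σ : ℂ) * ∏ a, ∏ b ∈ Finset.Ioi a, (v t (σ a) - q * v t (σ b)) else 0 := by
    refine continuous_finsetSum _ fun σ _ => ?_
    split_ifs
    · exact continuous_const.mul (continuous_finsetProd _ fun a _ =>
        continuous_finsetProd _ fun b _ => (hvc _).sub (continuous_const.mul (hvc _)))
    · exact continuous_const
  have hR : Continuous fun t => (∏ a, (1 - q ^ (laterEqual l a + 1)) / (1 - q)) *
        ∏ a, ∏ b ∈ Finset.Ioi a, (if l b = l a then v t a - v t b else v t a - q * v t b) := by
    refine continuous_const.mul (continuous_finsetProd _ fun a _ =>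
      continuous_finsetProd _ fun b _ => ?_)
    split_ifs
    · exact (hvc _).sub (hvc _)
    · exact (hvc _).sub (continuous_const.mul (hvc _))
  have h := tendsto_nhds_unique_of_eventuallyEq
    ((hL.tendsto 0).mono_left (nhdsWithin_le_nhds (s := {0}ᶜ)))
    ((hR.tendsto 0).mono_left (nhdsWithin_le_nhds (s := {0}ᶜ)))
    (hcond.mono fun t ht => hgen (v t) ht.1 ht.2)
  simpa only [hv0] using h

/-- A product over the pairs of positions, rewritten as a product over the pairs of values. -/
lemma prod_Ioi_comp_perm_eq_ite (σ : Equiv.Perm (Fin k)) (g : Fin k → Fin k → ℂ) :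
    ∏ a, ∏ b ∈ Finset.Ioi a, g (σ a) (σ b) =
      ∏ a, ∏ b ∈ Finset.Ioi a, if σ.symm b < σ.symm a then g b a else g a b := by
  have h := Finset.prod_prod_Ioi_mul_eq_prod_prod_off_diag
    (fun j i : Fin k => if σ.symm i < σ.symm j then g i j else 1)
  have e1 : ∏ a, ∏ b ∈ Finset.Ioi a, (if σ.symm b < σ.symm a then g b a else g a b) =
      ∏ i, ∏ j ∈ Finset.Ioi i, ((if σ.symm i < σ.symm j then g i j else 1) *
        (if σ.symm j < σ.symm i then g j i else 1)) := by
    refine Finset.prod_congr rfl fun a _ => Finset.prod_congr rfl fun b hb => ?_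
    have hne : σ.symm a ≠ σ.symm b := fun e => (Finset.mem_Ioi.1 hb).ne (σ.symm.injective e)
    rcases lt_or_gt_of_ne hne with h1 | h1
    · simp [h1, h1.not_gt]
    · simp [h1, h1.not_gt]
  rw [e1, h]
  have e2 : ∀ i, ∏ j ∈ {i}ᶜ, (if σ.symm i < σ.symm j then g i j else 1) =
      ∏ j, (if σ.symm i < σ.symm j then g i j else 1) := by
    intro i
    refine Finset.prod_subset (Finset.subset_univ _) fun j _ hj => ?_
    have : j = i := by simpa using hj
    simp [this]
  simp only [e2]
  refine Eq.trans ?_ (Equiv.prod_comp σ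
    fun i => ∏ j, (if σ.symm i < σ.symm j then g i j else 1))
  refine Finset.prod_congr rfl fun a _ => ?_
  rw [prod_Ioi_eq_prod_ite]
  refine Eq.trans ?_ (Equiv.prod_comp σ
    fun j => (if σ.symm (σ a) < σ.symm j then g (σ a) j else 1))
  simp

/-! ### Expansion of the nested integrand over permutations -/

/-- After multiplication by the Vandermonde product, the sum over permutations that defines `F` has
polynomial coefficients; where two variables coincide, both sides vanish by antisymmetry. -/
lemma prod_sub_mul_sum_perm (q : ℂ) (u : Fin k → ℂ) (Φ : (Fin k → ℂ) → ℂ) :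
    (∏ a, ∏ b ∈ Finset.Ioi a, (u a - u b)) * ∑ σ : Equiv.Perm (Fin k),
      (∏ a, ∏ b ∈ Finset.Ioi a, (u (σ a) - q * u (σ b)) / (u (σ a) - u (σ b))) * Φ (u ∘ σ) =
    ∑ σ : Equiv.Perm (Fin k), (Equiv.Perm.sign σ : ℂ) *
      (∏ a, ∏ b ∈ Finset.Ioi a, (u (σ a) - q * u (σ b))) * Φ (u ∘ σ) := by
  by_cases hu : Function.Injective u
  · rw [Finset.mul_sum]
    refine Finset.sum_congr rfl fun σ _ => ?_
    rw [← mul_assoc, prod_div_sub_mul_prod_sub hu]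
  · simp only [Function.Injective, not_forall] at hu
    obtain ⟨i, j, hij, hne⟩ := hu
    have h0 : ∏ a, ∏ b ∈ Finset.Ioi a, (u a - u b) = 0 := by
      rcases lt_or_gt_of_ne hne with h | h
      · exact Finset.prod_eq_zero (Finset.mem_univ i)
          (Finset.prod_eq_zero (Finset.mem_Ioi.2 h) (sub_eq_zero.2 hij))
      · exact Finset.prod_eq_zero (Finset.mem_univ j)
          (Finset.prod_eq_zero (Finset.mem_Ioi.2 h) (sub_eq_zero.2 hij.symm))
    rw [h0, zero_mul]
    have hswap : ∀ x, u (Equiv.swap i j x) = u x := by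
      intro x
      rw [Equiv.swap_apply_def]
      split_ifs with h1 h2
      · rw [h1, hij]
      · rw [h2, hij]
      · rfl
    have h := Equiv.sum_comp (Equiv.mulLeft (Equiv.swap i j)) fun σ : Equiv.Perm (Fin k) =>
      (Equiv.Perm.sign σ : ℂ) * (∏ a, ∏ b ∈ Finset.Ioi a, (u (σ a) - q * u (σ b))) * Φ (u ∘ σ)
    have hcomp : ∀ σ : Equiv.Perm (Fin k), u ∘ (Equiv.swap i j * σ : Equiv.Perm (Fin k)) = u ∘ σ :=
      fun σ => funext fun x => by simp [hswap]
    simp only [Equiv.coe_mulLeft, hcomp, Equiv.Perm.sign_mul, Equiv.Perm.sign_swap hne,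
      Equiv.Perm.mul_apply, hswap] at h
    simp only [neg_mul, one_mul, Units.val_neg, Int.cast_neg, Finset.sum_neg_distrib] at h
    have h2 := add_eq_zero_iff_eq_neg.2 h.symm
    rwa [add_self_eq_zero, eq_comm] at h2

/-- The contribution of the permutation `σ` to `nestedIntegrand`, up to a constant factor. -/
noncomputable def permTerm (q s : ℂ) (lam mu : Signature k) (σ : Equiv.Perm (Fin k))
    (u : Fin k → ℂ) : ℂ :=
  (Equiv.Perm.sign σ : ℂ) *
    (∏ a, ∏ b ∈ Finset.Ioi a,
      if σ.symm b < σ.symm a then (u b - q * u a) / (u a - q * u b) else 1) *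
    ∏ a, ((u a - s) / (1 - s * u a)) ^ lam.1 (σ.symm a) *
      (1 / (u a - s) * ((1 - s * u a) / (u a - s)) ^ mu.1 a / (1 - s * u a))

lemma sign_mul_prod_div {q : ℂ} {u : Fin k → ℂ} (hne : ∀ a b, a < b → u a - q * u b ≠ 0)
    (σ : Equiv.Perm (Fin k)) :
    (∏ a, ∏ b ∈ Finset.Ioi a, (u (σ a) - q * u (σ b))) /
      (∏ a, ∏ b ∈ Finset.Ioi a, (u a - q * u b)) =
    ∏ a, ∏ b ∈ Finset.Ioi a,
      if σ.symm b < σ.symm a then (u b - q * u a) / (u a - q * u b) else 1 := by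
  rw [prod_Ioi_comp_perm_eq_ite σ fun a b => u a - q * u b]
  simp only [← Finset.prod_div_distrib]
  refine Finset.prod_congr rfl fun a _ => Finset.prod_congr rfl fun b hb => ?_
  split_ifs
  · rfl
  · exact div_self (hne a b (Finset.mem_Ioi.1 hb))

/-- This also holds where two of the variables coincide, although `F` is a junk value there. -/
lemma nestedIntegrand_eq_sum {q : ℂ} (s : ℂ) {u : Fin k → ℂ}
    (hne : ∀ a b, a < b → u a - q * u b ≠ 0) (lam mu : Signature k) :
    nestedIntegrand q s lam mu u =
      cConst q s lam * (1 - q) ^ k * ∑ σ, permTerm q s lam mu σ u := by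
  have h := prod_sub_mul_sum_perm q u fun v => ∏ i, ((v i - s) / (1 - s * v i)) ^ lam.1 i
  have e : ∀ σ : Equiv.Perm (Fin k), permTerm q s lam mu σ u =
      ((Equiv.Perm.sign σ : ℂ) * (∏ a, ∏ b ∈ Finset.Ioi a, (u (σ a) - q * u (σ b))) *
        ∏ i, ((u (σ i) - s) / (1 - s * u (σ i))) ^ lam.1 i) *
      ((∏ a, ∏ b ∈ Finset.Ioi a, (u a - q * u b))⁻¹ * (∏ i, (1 - s * u i))⁻¹ *
        ∏ i, 1 / (u i - s) * ((1 - s * u i) / (u i - s)) ^ mu.1 i) := by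
    intro σ
    rw [permTerm, ← sign_mul_prod_div hne]
    have e1 : ∏ i, ((u (σ i) - s) / (1 - s * u (σ i))) ^ lam.1 i =
        ∏ a, ((u a - s) / (1 - s * u a)) ^ lam.1 (σ.symm a) := by
      refine Eq.trans ?_
        (Equiv.prod_comp σ fun a => ((u a - s) / (1 - s * u a)) ^ lam.1 (σ.symm a))
      simp
    rw [e1]
    simp only [Finset.prod_mul_distrib, div_eq_mul_inv,
      Finset.prod_inv_distrib]
    ring
  rw [Finset.sum_congr rfl fun σ _ => e σ, ← Finset.sum_mul]
  simp only [Function.comp_def] at h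
  rw [← h]
  have hsplit : ∏ a, ∏ b ∈ Finset.Ioi a, (u a - u b) / (u a - q * u b) =
      (∏ a, ∏ b ∈ Finset.Ioi a, (u a - u b)) *
        (∏ a, ∏ b ∈ Finset.Ioi a, (u a - q * u b))⁻¹ := by
    simp only [div_eq_mul_inv, Finset.prod_mul_distrib,
      Finset.prod_inv_distrib]
  rw [nestedIntegrand, Fc, F, hsplit]
  ring

/-! ### The geometry of the nested contours -/

section Nested

variable {q s : ℝ} {γ : Fin k → Contour}

lemma ne_zero_of_mem_trace {γ : Contour} (h1 : (s : ℂ) ∈ γ.inside)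
    (h2 : (s : ℂ)⁻¹ ∈ γ.outside) {x : ℂ} (hx : x ∈ γ.trace) :
    x - s ≠ 0 ∧ 1 - s * x ≠ 0 := by
  refine ⟨fun e => h1.1 (sub_eq_zero.1 e ▸ hx), fun e => h2.1 ?_⟩
  have : x = (s : ℂ)⁻¹ := by
    exact eq_inv_of_mul_eq_one_left (by linear_combination -e)
  exact this ▸ hx

namespace IsNested

lemma sub_ne_zero (h : IsNested q s γ) {u : Fin k → ℂ} (hu : ∀ i, u i ∈ (γ i).trace)
    (a b : Fin k) (hab : a < b) : u a - q * u b ≠ 0 := fun e =>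
  (h.nested a b hab _ (hu b)).1 (_root_.sub_eq_zero.1 e ▸ hu a)

lemma pow_mul_mem_inside (h : IsNested q s γ) (hq : q ≠ 0) (r : ℕ) (a : Fin k)
    (hr : r + (a : ℕ) < k) : (q : ℂ) ^ r * s ∈ (γ a).inside := by
  induction r generalizing a with
  | zero => simpa using h.encircles a
  | succ r ih =>
    have hb := ih ⟨(a : ℕ) + 1, by omega⟩ (by simp only; omega)
    rw [pow_succ', mul_assoc]
    refine Contour.mul_mem_inside (by exact_mod_cast hq) ?_ hb
    exact h.nested a _ (Fin.lt_def.2 (by simp))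

end IsNested

lemma continuousOn_permTerm (h : IsNested q s γ) (lam mu : Signature k)
    (σ : Equiv.Perm (Fin k)) :
    ContinuousOn (permTerm q s lam mu σ) (univ.pi fun i => (γ i).trace) := by
  have hc : ∀ i, ContinuousOn (fun u : Fin k → ℂ => u i) (univ.pi fun i => (γ i).trace) :=
    fun i => (continuous_apply i).continuousOn
  have hne := fun (u : Fin k → ℂ) (hu : u ∈ univ.pi fun i => (γ i).trace) (a : Fin k) =>
    ne_zero_of_mem_trace (h.encircles a) (h.leaves_outside a) (hu a (mem_univ a))
  have hcs : ∀ i, ContinuousOn (fun u : Fin k → ℂ => u i - s) (univ.pi fun i => (γ i).trace) :=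
    fun i => (hc i).sub continuousOn_const
  have hcs' : ∀ i, ContinuousOn (fun u : Fin k → ℂ => 1 - s * u i)
      (univ.pi fun i => (γ i).trace) :=
    fun i => continuousOn_const.sub (continuousOn_const.mul (hc i))
  unfold permTerm
  refine (continuousOn_const.mul (continuousOn_finsetProd _ fun a _ =>
    continuousOn_finsetProd _ fun b hb => ?_)).mul (continuousOn_finsetProd _ fun a _ => ?_)
  · split_ifs
    · refine ((hc b).sub (continuousOn_const.mul (hc a))).div
        ((hc a).sub (continuousOn_const.mul (hc b))) fun u hu => ?_
      exact h.sub_ne_zero (fun i => hu i (mem_univ i)) a b (Finset.mem_Ioi.1 hb)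
    · exact continuousOn_const
  · refine (((hcs a).div (hcs' a) fun u hu => (hne u hu a).2).pow _).mul
      (((continuousOn_const.div (hcs a) fun u hu => (hne u hu a).1).mul
      (((hcs' a).div (hcs a) fun u hu => (hne u hu a).1).pow _)).div (hcs' a)
      fun u hu => (hne u hu a).2)

lemma contourIntegrable_permTerm (h : IsNested q s γ) (lam mu : Signature k)
    (σ : Equiv.Perm (Fin k)) : ContourIntegrable γ (permTerm q s lam mu σ) :=
  contourIntegrable_of_continuousOn (continuousOn_permTerm h lam mu σ)

/-- A contribution vanishes if, as a function of a single variable, it is rational without poles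
inside the contour, or without poles outside the contour and with decay `x⁻²`. -/
lemma contourIntegral_permTerm_eq_zero (h : IsNested q s γ) (lam mu : Signature k) (σ : Equiv.Perm (Fin k)) (c : Fin k) (w : ℂ) (d : ℤ)
    (hw : w = 0 ∨ d ≤ -2)
    (hpair : ∀ u : Fin k → ℂ, (∀ i, i ≠ c → u i ∈ (γ i).trace) → ∀ a b, a < b →
      σ.symm b < σ.symm a → (γ c).RationalOn w 0 (γ c).trace fun x =>
        (Function.update u c x b - q * Function.update u c x a) /
          (Function.update u c x a - q * Function.update u c x b))
    (hone : (γ c).RationalOn w d (γ c).trace fun x =>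
      ((x - s) / (1 - s * x)) ^ lam.1 (σ.symm c) *
        (1 / (x - s) * ((1 - s * x) / (x - s)) ^ mu.1 c / (1 - s * x))) :
    contourIntegral γ (permTerm q s lam mu σ) = 0 := by
  refine contourIntegral_eq_zero_of_update c (contourIntegrable_permTerm h lam mu σ)
    fun u hu => Contour.RationalOn.cauchyIntegral_eq_zero (w := w) (d := d) ?_ hw
  have h1 : (γ c).RationalOn w (∑ a : Fin k, ∑ b ∈ Finset.Ioi a, 0) (γ c).trace fun x =>
      ∏ a, ∏ b ∈ Finset.Ioi a, if σ.symm b < σ.symm a then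
        (Function.update u c x b - q * Function.update u c x a) /
          (Function.update u c x a - q * Function.update u c x b) else 1 := by
    refine Contour.RationalOn.prod _ fun a _ => Contour.RationalOn.prod _ fun b hb => ?_
    split_ifs with hab
    · exact hpair u hu a b (Finset.mem_Ioi.1 hb) hab
    · exact Contour.RationalOn.const 1
  have h2 : (γ c).RationalOn w (∑ a : Fin k, if a = c then d else 0) (γ c).trace fun x =>
      ∏ a, ((Function.update u c x a - s) / (1 - s * Function.update u c x a)) ^
          lam.1 (σ.symm a) *
        (1 / (Function.update u c x a - s) * ((1 - s * Function.update u c x a) /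
          (Function.update u c x a - s)) ^ mu.1 a / (1 - s * Function.update u c x a)) := by
    refine Contour.RationalOn.prod _ fun a _ => ?_
    split_ifs with hac
    · subst hac
      simpa only [Function.update_self] using hone
    · simp only [Function.update_of_ne hac]
      exact Contour.RationalOn.const _
  have h3 := ((Contour.RationalOn.const (γ := γ c) (w := w) (S := (γ c).trace)
    (Equiv.Perm.sign σ : ℂ)).mul h1).mul h2
  simpa only [permTerm, Finset.sum_const_zero, zero_add, Finset.sum_ite_eq', Finset.mem_univ,
    if_true] using h3

lemma pow_mul_mul_pow_div {A B : ℂ} (c e : ℂ) (h : B * A = 1) (L n : ℕ) :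
    B ^ L * (c * A ^ (L + n + 1) / e) = A ^ n * (A * (c / e)) := by
  calc _ = (B * A) ^ L * (A ^ n * (A * (c / e))) := by rw [mul_pow]; ring
    _ = _ := by rw [h, one_pow, one_mul]

/-- Here no interaction pole and, by the surplus of factors `u c - s`, no pole at `s` lies inside the
contour of the variable `c`. -/
lemma contourIntegral_permTerm_of_lt (h : IsNested q s γ) (hq : q ≠ 0) (hs : s ≠ 0)
    (lam mu : Signature k) (σ : Equiv.Perm (Fin k)) (c : Fin k)
    (hc : ∀ b, c < b → ¬σ.symm b < σ.symm c) (hlt : mu.1 c < lam.1 (σ.symm c)) :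
    contourIntegral γ (permTerm q s lam mu σ) = 0 := by
  have hqc : (q : ℂ) ≠ 0 := by exact_mod_cast hq
  have hsc : (s : ℂ) ≠ 0 := by exact_mod_cast hs
  refine contourIntegral_permTerm_eq_zero h lam mu σ c 0
    ((lam.1 (σ.symm c) - mu.1 c - 1 : ℕ) * 0 + (2 : ℕ) * -1) (Or.inl rfl) ?_ ?_
  · intro u hu a b hab hinv
    by_cases hac : a = c
    · subst hac
      exact absurd hinv (hc b hab)
    by_cases hbc : b = c
    · subst hbc
      have hout := Contour.div_mem_outside hqc (h.nested a b hab) (hu a hac)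
      have e : -(u a) / -(q : ℂ) = u a / q := by rw [neg_div_neg_eq]
      have := Contour.RationalOn.linear_div_linear (γ := γ b) (w := 0) (S := (γ b).trace) 1
        (-q * u a) (-q) (u a) (neg_ne_zero.2 hqc) (e ▸ hout)
      refine this.congr fun x _ => ?_
      simp only [Function.update_self, Function.update_of_ne hac]
      congr 1 <;> ring
    · simp only [Function.update_of_ne hac, Function.update_of_ne hbc]
      exact Contour.RationalOn.const _
  · have e : -(1 : ℂ) / -(s : ℂ) = (s : ℂ)⁻¹ := by rw [neg_div_neg_eq, one_div]
    have hout : -(1 : ℂ) / -(s : ℂ) ∉ (γ c).trace ∧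
        windingNumber (γ c).toFun (-(1 : ℂ) / -(s : ℂ)) = 0 := e ▸ h.leaves_outside c
    have h1 := Contour.RationalOn.linear_div_linear (γ := γ c) (w := 0) (S := (γ c).trace) 1
        (-s) (-s) 1 (neg_ne_zero.2 hsc) hout
    have h2 := Contour.RationalOn.inv_linear (γ := γ c) (w := 0) (S := (γ c).trace)
        (-s) 1 (neg_ne_zero.2 hsc) hout
    refine ((h1.pow (lam.1 (σ.symm c) - mu.1 c - 1)).mul (h2.pow 2)).congr fun x hx => ?_
    obtain ⟨g1, g2⟩ := ne_zero_of_mem_trace (h.encircles c) (h.leaves_outside c) hx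
    have g2' : 1 - x * (s : ℂ) ≠ 0 := by rwa [mul_comm]
    obtain ⟨n, hn⟩ := Nat.exists_eq_add_of_lt hlt
    have g3 : -(s : ℂ) * x + 1 = 1 - s * x := by ring
    have g4 : 1 * x + -(s : ℂ) = x - s := by ring
    rw [hn, show mu.1 c + n + 1 - mu.1 c - 1 = n by omega, g3, g4]
    refine Eq.trans ?_ ((pow_mul_mul_pow_div (B := (1 - s * x) / (x - s)) (1 / (x - s)) (1 - s * x)
      (by rw [← inv_div (x - (s : ℂ)), inv_mul_cancel₀ (div_ne_zero g1 g2)]) (mu.1 c) n).trans ?_)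
    · ring
    · field_simp

/-- Here all interaction poles lie inside the contour of the variable `c`, the surplus of factors
`1 - s * u c` removes the pole at `s⁻¹`, and the integrand decays like the inverse square. -/
lemma contourIntegral_permTerm_of_gt (h : IsNested q s γ) (lam mu : Signature k) (σ : Equiv.Perm (Fin k)) (c : Fin k)
    (hc : ∀ a, a < c → ¬σ.symm c < σ.symm a) (hlt : lam.1 (σ.symm c) < mu.1 c) :
    contourIntegral γ (permTerm q s lam mu σ) = 0 := by
  refine contourIntegral_permTerm_eq_zero h lam mu σ c 1 (-2) (Or.inr le_rfl) ?_ ?_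
  · intro u hu a b hab hinv
    by_cases hbc : b = c
    · subst hbc
      exact absurd hinv (hc a hab)
    by_cases hac : a = c
    · subst hac
      have hin := h.nested a b hab _ (hu b hbc)
      have e : -(-q * u b) / 1 = q * u b := by ring
      have := Contour.RationalOn.linear_div_linear (γ := γ a) (w := 1) (S := (γ a).trace) (-q)
        (u b) 1 (-q * u b) one_ne_zero (e ▸ hin)
      refine this.congr fun x _ => ?_
      simp only [Function.update_self, Function.update_of_ne hbc]
      congr 1 <;> ring
    · simp only [Function.update_of_ne hac, Function.update_of_ne hbc]
      exact Contour.RationalOn.const _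
  · have e : -(-(s : ℂ)) / 1 = (s : ℂ) := by ring
    have hin : -(-(s : ℂ)) / 1 ∉ (γ c).trace ∧
        windingNumber (γ c).toFun (-(-(s : ℂ)) / 1) = 1 := e.symm ▸ h.encircles c
    have h1 := Contour.RationalOn.linear_div_linear (γ := γ c) (w := 1) (S := (γ c).trace) (-s)
        1 1 (-s) one_ne_zero hin
    have h2 := Contour.RationalOn.inv_linear (γ := γ c) (w := 1) (S := (γ c).trace)
        1 (-s) one_ne_zero hin
    have h3 := ((h1.pow (mu.1 c - lam.1 (σ.symm c) - 1)).mul (h2.pow 2))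
    rw [mul_zero, zero_add] at h3
    refine h3.congr fun x hx => ?_
    obtain ⟨g1, g2⟩ := ne_zero_of_mem_trace (h.encircles c) (h.leaves_outside c) hx
    have g2' : 1 - x * (s : ℂ) ≠ 0 := by rwa [mul_comm]
    obtain ⟨n, hn⟩ := Nat.exists_eq_add_of_lt hlt
    have g3 : -(s : ℂ) * x + 1 = 1 - s * x := by ring
    have g4 : 1 * x + -(s : ℂ) = x - s := by ring
    rw [hn, show lam.1 (σ.symm c) + n + 1 - lam.1 (σ.symm c) - 1 = n by omega, g3, g4,
      pow_mul_mul_pow_div _ _ (by rw [← inv_div (x - (s : ℂ)), mul_inv_cancel₀ (div_ne_zero g1 g2)])]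
    field_simp

/-- Only permutations that carry `mu` to `lam` contribute. The extreme indices of a level set of
`lam ∘ σ⁻¹` have all their interaction poles on one side of the contour. -/
lemma comp_symm_eq_of_contourIntegral_permTerm_ne_zero (h : IsNested q s γ) (hq : q ≠ 0)
    (hs : s ≠ 0) (lam mu : Signature k) (σ : Equiv.Perm (Fin k))
    (hne : contourIntegral γ (permTerm q s lam mu σ) ≠ 0) (c : Fin k) :
    lam.1 (σ.symm c) = mu.1 c := by
  apply le_antisymm
  · obtain ⟨m, hm, hmax⟩ := Finset.exists_max_image
      (Finset.univ.filter fun b => lam.1 (σ.symm c) ≤ lam.1 (σ.symm b)) id ⟨c, by simp⟩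
    simp only [Finset.mem_filter, Finset.mem_univ, true_and, id] at hm hmax
    refine hm.trans (le_trans ?_ (mu.2 (hmax c le_rfl)))
    by_contra! hlt
    refine hne (contourIntegral_permTerm_of_lt h hq hs lam mu σ m (fun b hb hinv => ?_) hlt)
    exact hb.not_ge (hmax b (hm.trans (lam.2 hinv.le)))
  · obtain ⟨m, hm, hmin⟩ := Finset.exists_min_image
      (Finset.univ.filter fun b => lam.1 (σ.symm b) ≤ lam.1 (σ.symm c)) id ⟨c, by simp⟩
    simp only [Finset.mem_filter, Finset.mem_univ, true_and, id] at hm hmin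
    refine le_trans (mu.2 (hmin c le_rfl)) (le_trans ?_ hm)
    by_contra! hlt
    refine hne (contourIntegral_permTerm_of_gt h lam mu σ m (fun a ha hinv => ?_) hlt)
    exact ha.not_ge (hmin a ((lam.2 hinv.le).trans hm))

lemma eq_of_comp_symm_eq {lam mu : Signature k} {σ : Equiv.Perm (Fin k)}
    (h : ∀ c, lam.1 (σ.symm c) = mu.1 c) : lam = mu := by
  have := Tuple.unique_antitone (f := lam.1) (σ := Equiv.refl _) (τ := σ.symm) lam.2
    ((funext h : lam.1 ∘ σ.symm = mu.1) ▸ mu.2)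
  exact Subtype.ext (this.trans (funext h))

end Nested

/-! ### Evaluation of the diagonal integral -/

/-- The integrand to which the diagonal case reduces. The variables carry labels `l`; variables
with label `m` have a simple pole at `q ^ p m * s`, and only variables with equal labels interact.
The exponents `p` grow when variables are integrated out. -/
noncomputable def labelledIntegrand {k : ℕ} (q s : ℂ) (l : Fin k → ℕ) (p : ℕ → ℕ)
    (u : Fin k → ℂ) : ℂ :=
  (∏ a, ∏ b ∈ Finset.Ioi a, if l b = l a then (u a - u b) / (u a - q * u b) else 1) *
    ∏ a, 1 / ((1 - s * u a) * (u a - q ^ p (l a) * s))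

@[to_additive]
lemma prod_Ioi_castSucc {M : Type*} [CommMonoid M] {k : ℕ} (a : Fin k) (f : Fin (k + 1) → M) :
    ∏ b ∈ Finset.Ioi a.castSucc, f b =
      (∏ b ∈ Finset.Ioi a, f b.castSucc) * f (Fin.last k) := by
  rw [prod_Ioi_eq_prod_ite, prod_Ioi_eq_prod_ite, Fin.prod_univ_castSucc]
  simp [Fin.castSucc_lt_last]

lemma laterEqual_castSucc {k : ℕ} (l : Fin (k + 1) → ℕ) (a : Fin k) :
    laterEqual l a.castSucc = laterEqual (fun i => l i.castSucc) a +
      if l (Fin.last k) = l a.castSucc then 1 else 0 := by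
  simp only [laterEqual, Finset.card_filter]
  exact sum_Ioi_castSucc a fun b => if l b = l a.castSucc then 1 else 0

lemma laterEqual_last {k : ℕ} (l : Fin (k + 1) → ℕ) : laterEqual l (Fin.last k) = 0 := by
  have : Finset.Ioi (Fin.last k) = ∅ := by
    ext b
    simp [Fin.le_last]
  rw [laterEqual, this]
  simp

lemma labelledIntegrand_snoc {k : ℕ} (q s : ℂ) (l : Fin (k + 1) → ℕ) (p : ℕ → ℕ)
    (u : Fin k → ℂ) (x : ℂ) :
    labelledIntegrand q s l p (Fin.snoc (α := fun _ => ℂ) u x) =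
      labelledIntegrand q s (fun i => l i.castSucc) p u *
      ((x - q ^ p (l (Fin.last k)) * s)⁻¹ * ((∏ a : Fin k, if l (Fin.last k) = l a.castSucc then
        (u a - x) / (u a - q * x) else 1) * (1 / (1 - s * x)))) := by
  have : Finset.Ioi (Fin.last k) = ∅ := by
    ext b
    simp [Fin.le_last]
  simp only [labelledIntegrand, Fin.prod_univ_castSucc, prod_Ioi_castSucc, this,
    Finset.prod_empty, Fin.snoc_castSucc, Fin.snoc_last, Finset.prod_mul_distrib, mul_one]
  simp only [one_div, mul_inv]
  ring

lemma continuousOn_labelledIntegrand {k : ℕ} {q s : ℂ} {l : Fin k → ℕ} {p : ℕ → ℕ}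
    {γ : Fin k → Contour}
    (hnest : ∀ a b, a < b → ∀ z ∈ (γ b).trace, q * z ∈ (γ a).inside)
    (hout : ∀ a, ∀ x ∈ (γ a).trace, 1 - s * x ≠ 0)
    (hin : ∀ a, q ^ p (l a) * s ∈ (γ a).inside) :
    ContinuousOn (labelledIntegrand q s l p) (univ.pi fun i => (γ i).trace) := by
  have hc : ∀ i, ContinuousOn (fun u : Fin k → ℂ => u i) (univ.pi fun i => (γ i).trace) :=
    fun i => (continuous_apply i).continuousOn
  refine (continuousOn_finsetProd _ fun a _ => continuousOn_finsetProd _ fun b hb => ?_).mul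
    (continuousOn_finsetProd _ fun a _ => ?_)
  · split_ifs
    · refine ((hc a).sub (hc b)).div ((hc a).sub (continuousOn_const.mul (hc b))) fun u hu e => ?_
      exact (hnest a b (Finset.mem_Ioi.1 hb) _ (hu b (mem_univ b))).1
        (sub_eq_zero.1 e ▸ hu a (mem_univ a))
    · exact continuousOn_const
  · refine continuousOn_const.div ((continuousOn_const.sub (continuousOn_const.mul (hc a))).mul
      ((hc a).sub continuousOn_const)) fun u hu => mul_ne_zero (hout a _ (hu a (mem_univ a))) ?_
    exact fun e => (hin a).1 (sub_eq_zero.1 e ▸ hu a (mem_univ a))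

/-- The last variable is integrated out first: inside its contour its only pole is
`q ^ p (l (Fin.last k)) * s`. The residue moves the pole of every other variable with the same
label one step, to `q ^ (p (l (Fin.last k)) + 1) * s`. -/
lemma contourIntegral_labelledIntegrand {k : ℕ} {q s : ℂ} (hq : q ≠ 0) (hs : s ≠ 0)
    (l : Fin k → ℕ) (p : ℕ → ℕ) (γ : Fin k → Contour)
    (hnest : ∀ a b, a < b → ∀ z ∈ (γ b).trace, q * z ∈ (γ a).inside)
    (hout : ∀ a, s⁻¹ ∈ (γ a).outside)
    (hin : ∀ (a : Fin k) (r : ℕ), r + (a : ℕ) < p (l a) + k → q ^ r * s ∈ (γ a).inside) :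
    contourIntegral γ (labelledIntegrand q s l p) =
      ∏ a, 1 / (1 - s ^ 2 * q ^ (p (l a) + laterEqual l a)) := by
  have hout' : ∀ a, ∀ x ∈ (γ a).trace, 1 - s * x ≠ 0 := fun a x hx e => (hout a).1 (by
    have : x = s⁻¹ := eq_inv_of_mul_eq_one_left (by linear_combination -e)
    exact this ▸ hx)
  induction k generalizing p with
  | zero =>
    rw [contourIntegral, volume_restrict_Icc, Measure.pi_of_empty]
    simp [pullback, labelledIntegrand]
  | succ k ih =>
    have hcont := continuousOn_labelledIntegrand hnest hout' (p := p) (l := l)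
      (fun a => hin a _ (by omega))
    rw [contourIntegral_succAbove (Fin.last k) (contourIntegrable_of_continuousOn hcont)]
    set m := l (Fin.last k) with hm
    have hpole : q ^ p m * s ∈ (γ (Fin.last k)).inside :=
      hin _ _ (by rw [Fin.val_last, ← hm]; omega)
    set p' := Function.update p m (p m + 1) with hp'
    have hp'le : ∀ i : Fin k, p' (l i.castSucc) ≤ p (l i.castSucc) + 1 := by
      intro i
      rw [hp', Function.update_apply]
      split_ifs with h
      · rw [h]
      · omega
    have e : ∀ u : Fin k → ℂ, (∀ i, u i ∈ (γ ((Fin.last k).succAbove i)).trace) →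
        cauchyIntegral (γ (Fin.last k)) (fun x => labelledIntegrand q s l p
          ((Fin.last k).insertNth x u)) =
        1 / (1 - s ^ 2 * q ^ p m) * labelledIntegrand q s (fun i => l i.castSucc) p' u := by
      intro u hu
      simp only [Fin.succAbove_last] at hu
      have e1 : ∀ x, (Fin.last k).insertNth (α := fun _ => ℂ) x u =
          Fin.snoc (α := fun _ => ℂ) u x := fun x => Fin.insertNth_last' x u
      simp only [e1, labelledIntegrand_snoc]
      rw [Contour.cauchyIntegral_const_mul]
      have hrat : (γ (Fin.last k)).RationalOn 0 ((∑ _a : Fin k, (0 : ℤ)) + -1) univ fun x =>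
          (∏ a : Fin k, if l (Fin.last k) = l a.castSucc then
            (u a - x) / (u a - q * x) else 1) * (1 / (1 - s * x)) := by
        refine (Contour.RationalOn.prod _ fun a _ => ?_).mul ?_
        · split_ifs
          · have hua := Contour.div_mem_outside hq
              (hnest a.castSucc (Fin.last k) (Fin.castSucc_lt_last a)) (hu a)
            have h1 : -(u a) / -q = u a / q := by rw [neg_div_neg_eq]
            refine (Contour.RationalOn.linear_div_linear (-1) (u a) (-q) (u a)
              (neg_ne_zero.2 hq) (h1 ▸ hua)).congr fun x _ => ?_
            congr 1 <;> ring
          · exact Contour.RationalOn.const 1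
        · have h1 : -(1 : ℂ) / -s = s⁻¹ := by rw [neg_div_neg_eq, one_div]
          have h2 : -(1 : ℂ) / -s ∉ (γ (Fin.last k)).trace ∧
            windingNumber (γ (Fin.last k)).toFun (-(1 : ℂ) / -s) = 0 := h1 ▸ hout _
          refine (Contour.RationalOn.inv_linear (-s) 1 (neg_ne_zero.2 hs) h2).congr fun x _ => ?_
          congr 1
          ring
      rw [Contour.RationalOn.cauchyIntegral_inv_sub_mul hpole hrat]
      have e2 : 1 - s * (q ^ p m * s) = 1 - s ^ 2 * q ^ p m := by ring
      rw [e2, mul_comm (1 / _) (labelledIntegrand _ _ _ _ _), ← mul_assoc]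
      congr 1
      simp only [labelledIntegrand]
      rw [mul_assoc, ← Finset.prod_mul_distrib]
      congr 1
      refine Finset.prod_congr rfl fun a _ => ?_
      by_cases hla : m = l a.castSucc
      · rw [← hm, if_pos hla, ← hla, hp', Function.update_self]
        have h1 : u a - q ^ p m * s ≠ 0 := fun e => by
          have h2 := hin a.castSucc (p m) (by rw [← hla, Fin.val_castSucc]; omega)
          exact h2.1 (sub_eq_zero.1 e ▸ hu a)
        rw [pow_succ', mul_assoc, one_div, one_div, mul_inv, mul_inv, div_eq_mul_inv]
        rw [show (1 - s * u a)⁻¹ * (u a - q ^ p m * s)⁻¹ *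
          ((u a - q ^ p m * s) * (u a - q * (q ^ p m * s))⁻¹) =
          (1 - s * u a)⁻¹ * ((u a - q ^ p m * s)⁻¹ *
          (u a - q ^ p m * s)) * (u a - q * (q ^ p m * s))⁻¹ by ring, inv_mul_cancel₀ h1, mul_one]
      · rw [← hm, if_neg hla, mul_one, hp', Function.update_of_ne (Ne.symm hla)]
    rw [contourIntegral_congr e, contourIntegral_const_mul]
    simp only [Fin.succAbove_last]
    rw [ih (fun i => l i.castSucc) p' (fun i => γ i.castSucc)
      (fun a b hab => hnest _ _ (Fin.castSucc_lt_castSucc_iff.2 hab)) (fun a => hout _)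
      (fun a r hr => hin a.castSucc r (by
        have := hp'le a
        simp only [Fin.val_castSucc]
        omega)) (fun a => hout' _), Fin.prod_univ_castSucc, mul_comm]
    congr 1
    · refine Finset.prod_congr rfl fun a _ => ?_
      rw [laterEqual_castSucc]
      by_cases hla : m = l a.castSucc
      · rw [← hm, if_pos hla, ← hla, hp', Function.update_self]
        congr 4
        omega
      · rw [← hm, if_neg hla, hp', Function.update_of_ne (Ne.symm hla), add_zero]
    · rw [laterEqual_last, add_zero]

/-! ### The normalization -/

lemma prod_card_filter_lt {k : ℕ} (g : ℕ → ℂ) (S : Finset (Fin k)) :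
    ∏ a ∈ S, g ((S.filter fun b => a < b).card) = ∏ j ∈ Finset.range S.card, g j := by
  induction S using Finset.induction_on_min with
  | empty => simp
  | insert a S ha ih =>
    have hnot : a ∉ S := fun h => (ha a h).false
    rw [Finset.prod_insert hnot, Finset.card_insert_of_notMem hnot, Finset.prod_range_succ, mul_comm,
      ← ih]
    congr 1
    · refine Finset.prod_congr rfl fun b hb => ?_
      rw [Finset.filter_insert, if_neg (ha b hb).not_gt]
    · rw [Finset.filter_insert, if_neg (lt_irrefl a), Finset.filter_true_of_mem ha]

/-- Within each set of equal parts, `laterEqual` takes every value below the multiplicity once. -/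
lemma prod_laterEqual {k : ℕ} (lam : Signature k) (g : ℕ → ℂ) :
    ∏ a, g (laterEqual lam.1 a) =
      ∏ m ∈ Finset.univ.image lam.1, ∏ j ∈ Finset.range (multiplicity lam m), g j := by
  rw [← Finset.prod_fiberwise_of_maps_to (s := Finset.univ) (t := Finset.univ.image lam.1)
    (g := lam.1) fun a ha => Finset.mem_image_of_mem _ ha]
  refine Finset.prod_congr rfl fun m _ => ?_
  rw [multiplicity, ← prod_card_filter_lt]
  refine Finset.prod_congr rfl fun a ha => ?_
  rw [laterEqual]
  congr 2
  ext b
  rw [Finset.mem_filter] at ha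
  simp only [Finset.mem_filter, Finset.mem_Ioi, Finset.mem_univ, true_and, ha.2]
  exact and_comm

lemma cConst_eq {k : ℕ} (q s : ℂ) (lam : Signature k) :
    cConst q s lam = ∏ a, (1 - s ^ 2 * q ^ laterEqual lam.1 a) /
      (1 - q ^ (laterEqual lam.1 a + 1)) := by
  rw [prod_laterEqual lam fun r => (1 - s ^ 2 * q ^ r) / (1 - q ^ (r + 1))]
  simp only [cConst, qPoch, Finset.prod_div_distrib, pow_succ']

lemma one_sub_mul_pow_ne_zero {q c : ℝ} (hq0 : 0 < q) (hq1 : q < 1) (hc : c < 1)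
    (r : ℕ) : 1 - (c : ℂ) * (q : ℂ) ^ r ≠ 0 := by
  have h1 : 0 < q ^ r := pow_pos hq0 r
  have h2 : q ^ r ≤ 1 := pow_le_one₀ hq0.le hq1.le
  have h : 1 - c * q ^ r ≠ 0 := by
    rcases le_total c 0 with h | h <;> nlinarith
  exact_mod_cast h

/-! ### Biorthogonality -/

section

variable {q s : ℝ}

/-- The permutations that contribute when `lam = mu` sum up, before integration, to a multiple of
`labelledIntegrand`: the powers of `(u - s) / (1 - s * u)` cancel. -/
lemma sum_permTerm_eq {γ : Fin k → Contour} (h : IsNested q s γ) (hq1 : q ≠ 1)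
    (lam : Signature k) {u : Fin k → ℂ} (hu : ∀ i, u i ∈ (γ i).trace) :
    (∑ σ : Equiv.Perm (Fin k), if ∀ i, lam.1 (σ i) = lam.1 i then
      permTerm q s lam lam σ u else 0) =
      (∏ a, (1 - (q : ℂ) ^ (laterEqual lam.1 a + 1)) / (1 - q)) *
        labelledIntegrand q s lam.1 (fun _ => 0) u := by
  have hne := h.sub_ne_zero hu
  have hD : ∏ a, ∏ b ∈ Finset.Ioi a, (u a - q * u b) ≠ 0 :=
    Finset.prod_ne_zero_iff.2 fun a _ => Finset.prod_ne_zero_iff.2 fun b hb =>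
      hne a b (Finset.mem_Ioi.1 hb)
  have e1 : labelledIntegrand q s lam.1 (fun _ => 0) u =
      (∏ a, ∏ b ∈ Finset.Ioi a, (if lam.1 b = lam.1 a then u a - u b else u a - q * u b)) *
        ((∏ a, ∏ b ∈ Finset.Ioi a, (u a - q * u b))⁻¹ *
        ∏ a, 1 / ((1 - s * u a) * (u a - s))) := by
    rw [labelledIntegrand, ← mul_assoc, ← div_eq_mul_inv]
    simp only [← Finset.prod_div_distrib, pow_zero, one_mul]
    congr 1
    refine Finset.prod_congr rfl fun a _ => Finset.prod_congr rfl fun b hb => ?_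
    split_ifs
    · rfl
    · rw [div_self (hne a b (Finset.mem_Ioi.1 hb))]
  rw [e1, ← mul_assoc, ← sum_sign_mul_prod_sub (by exact_mod_cast hq1) lam.2, Finset.sum_mul]
  refine Finset.sum_congr rfl fun σ _ => ?_
  split_ifs with hσ
  · rw [permTerm, ← sign_mul_prod_div hne, div_eq_mul_inv]
    have e2 : ∀ a, ((u a - s) / (1 - s * u a)) ^ lam.1 (σ.symm a) *
        (1 / (u a - s) * ((1 - s * u a) / (u a - s)) ^ lam.1 a / (1 - s * u a)) =
        1 / ((1 - s * u a) * (u a - s)) := by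
      intro a
      obtain ⟨g1, g2⟩ := ne_zero_of_mem_trace (h.encircles a) (h.leaves_outside a) (hu a)
      have h1 : lam.1 (σ.symm a) = lam.1 a := by
        rw [← hσ (σ.symm a), Equiv.apply_symm_apply]
      have h2 : ((u a - s) / (1 - s * u a)) ^ lam.1 a *
          ((1 - s * u a) / (u a - s)) ^ lam.1 a = 1 := by
        rw [← mul_pow, ← inv_div (u a - (s : ℂ)), mul_inv_cancel₀ (div_ne_zero g1 g2), one_pow]
      rw [h1]
      calc _ = (((u a - s) / (1 - s * u a)) ^ lam.1 a *
          ((1 - s * u a) / (u a - s)) ^ lam.1 a) * (1 / (u a - s) / (1 - s * u a)) := by ring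
        _ = _ := by rw [h2, one_mul, div_div, mul_comm]
    simp only [e2]
    ring
  · rw [zero_mul]

theorem nested_biorthogonality (hq0 : 0 < q) (hq1 : q < 1) (hs0 : -1 < s) (hs1 : s < 0)
    (lam mu : Signature k) {γ : Fin k → Contour} (h : IsNested q s γ) :
    ContourIntegrable γ (nestedIntegrand q s lam mu) ∧
      contourIntegral γ (nestedIntegrand q s lam mu) = if lam = mu then 1 else 0 := by
  have hterm := contourIntegrable_permTerm h lam mu
  have e : ∀ u, (∀ i, u i ∈ (γ i).trace) → nestedIntegrand q s lam mu u =
      ∑ σ, cConst q s lam * (1 - q) ^ k * permTerm q s lam mu σ u := fun u hu => by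
    rw [nestedIntegrand_eq_sum _ (h.sub_ne_zero hu), Finset.mul_sum]
  have hint : ∀ σ, ContourIntegrable γ fun u =>
      cConst q s lam * (1 - q) ^ k * permTerm q s lam mu σ u := fun σ =>
    contourIntegrable_of_continuousOn (continuousOn_const.mul (continuousOn_permTerm h lam mu σ))
  refine ⟨(ContourIntegrable.sum _ fun σ _ => hint σ).congr fun u hu => (e u hu).symm, ?_⟩
  rw [contourIntegral_congr e, contourIntegral_sum _ fun σ _ => hint σ]
  simp only [contourIntegral_const_mul, ← Finset.mul_sum]
  have hzero := comp_symm_eq_of_contourIntegral_permTerm_ne_zero h hq0.ne' hs1.ne lam mu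
  split_ifs with hlm
  · subst hlm
    have e1 : ∑ σ, contourIntegral γ (permTerm q s lam lam σ) =
        ∑ σ : Equiv.Perm (Fin k) with ∀ i, lam.1 (σ i) = lam.1 i,
          contourIntegral γ (permTerm q s lam lam σ) := by
      refine (Finset.sum_filter_of_ne fun σ _ hne i => ?_).symm
      rw [← hzero σ hne, Equiv.symm_apply_apply]
    rw [e1, ← contourIntegral_sum _ fun σ _ => hterm σ, contourIntegral_congr
      (g := fun u => (∏ a, (1 - (q : ℂ) ^ (laterEqual lam.1 a + 1)) / (1 - q)) *
        labelledIntegrand q s lam.1 (fun _ => 0) u) fun u hu => by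
      rw [Finset.sum_filter, sum_permTerm_eq h hq1.ne lam hu], contourIntegral_const_mul,
      contourIntegral_labelledIntegrand (by exact_mod_cast hq0.ne') (by exact_mod_cast hs1.ne)
        _ _ _ h.nested h.leaves_outside
        fun a r hr => h.pow_mul_mem_inside hq0.ne' r a (by omega), cConst_eq]
    have hqk : (1 - (q : ℂ)) ^ k = ∏ _a : Fin k, (1 - (q : ℂ)) := by simp
    rw [hqk]
    simp only [← Finset.prod_mul_distrib]
    refine Finset.prod_eq_one fun a _ => ?_
    have h1 : 1 - (q : ℂ) ≠ 0 := by simpa using one_sub_mul_pow_ne_zero hq0 hq1 hq1 0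
    have h2 : 1 - (q : ℂ) ^ (laterEqual lam.1 a + 1) ≠ 0 := by
      rw [pow_succ']
      exact one_sub_mul_pow_ne_zero hq0 hq1 hq1 _
    have h3 : 1 - (s : ℂ) ^ 2 * (q : ℂ) ^ laterEqual lam.1 a ≠ 0 := by
      have := one_sub_mul_pow_ne_zero (c := s ^ 2) hq0 hq1 (by nlinarith) (laterEqual lam.1 a)
      rwa [Complex.ofReal_pow] at this
    rw [zero_add]
    field_simp
  · rw [Finset.sum_eq_zero, mul_zero]
    intro σ _
    by_contra hne
    exact hlm (eq_of_comp_symm_eq (hzero σ hne))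

end

/-! ### The symmetric form of the biorthogonality -/

lemma F_comp_perm (q s : ℂ) (lam : Signature k) (u : Fin k → ℂ) (τ : Equiv.Perm (Fin k)) :
    F q s lam (u ∘ τ) = F q s lam u := by
  simp only [F, Function.comp_apply]
  rw [Equiv.prod_comp τ fun i => 1 - s * u i]
  congr 1
  exact Equiv.sum_comp (Equiv.mulLeft τ) fun σ : Equiv.Perm (Fin k) =>
    (∏ α, ∏ β ∈ Finset.Ioi α, (u (σ α) - q * u (σ β)) / (u (σ α) - u (σ β))) *
      ∏ i, ((u (σ i) - s) / (1 - s * u (σ i))) ^ lam.1 i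

/-- Where two of the variables coincide, the corresponding factors vanish on both sides. -/
lemma prod_ne_mul_prod_Ioi {q : ℂ} {v : Fin k → ℂ} (hne : ∀ a b, v a - q * v b ≠ 0) :
    (∏ a, ∏ b ∈ Finset.univ.erase a, (v a - v b) / (v a - q * v b)) *
      ∏ a, ∏ b ∈ Finset.Ioi a, (v b - q * v a) / (v b - v a) =
    ∏ a, ∏ b ∈ Finset.Ioi a, (v a - v b) / (v a - q * v b) := by
  have h := Finset.prod_prod_Ioi_mul_eq_prod_prod_off_diag
    fun b a : Fin k => (v a - v b) / (v a - q * v b)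
  simp only [Finset.compl_singleton] at h
  rw [← h]
  simp only [← Finset.prod_mul_distrib]
  refine Finset.prod_congr rfl fun a _ => Finset.prod_congr rfl fun b _ => ?_
  by_cases hab : v b - v a = 0
  · have : v a - v b = 0 := by rw [← neg_sub, hab, neg_zero]
    simp [hab, this]
  · rw [mul_assoc, div_mul_div_cancel₀ (hne b a), div_self hab, mul_one]

lemma prod_erase_comp_perm (τ : Equiv.Perm (Fin k)) (g : Fin k → Fin k → ℂ) :
    ∏ a, ∏ b ∈ Finset.univ.erase a, g (τ a) (τ b) = ∏ a, ∏ b ∈ Finset.univ.erase a, g a b := by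
  refine Eq.trans ?_ (Equiv.prod_comp τ fun a => ∏ b ∈ Finset.univ.erase a, g a b)
  refine Finset.prod_congr rfl fun a _ => ?_
  have : Finset.univ.erase (τ a) = (Finset.univ.erase a).map τ.toEmbedding := by
    ext b
    simp
  rw [this, Finset.prod_map]
  rfl

lemma mul_F_inv {q s : ℂ} (mu : Signature k) {u : Fin k → ℂ} (h0 : ∀ i, u i ≠ 0) :
    (∏ i, 1 / u i) * F q s mu (fun i => (u i)⁻¹) =
      (1 - q) ^ k * ∑ τ : Equiv.Perm (Fin k),
        (∏ a, ∏ b ∈ Finset.Ioi a, (u (τ b) - q * u (τ a)) / (u (τ b) - u (τ a))) *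
          ∏ i, 1 / (u (τ i) - s) * ((1 - s * u (τ i)) / (u (τ i) - s)) ^ mu.1 i := by
  have e1 : ∀ i j, ((u i)⁻¹ - q * (u j)⁻¹) / ((u i)⁻¹ - (u j)⁻¹) =
      (u j - q * u i) / (u j - u i) := fun i j => by
    have hi := h0 i
    have hj := h0 j
    rw [show (u i)⁻¹ - q * (u j)⁻¹ = (u j - q * u i) / (u i * u j) by field_simp,
      show (u i)⁻¹ - (u j)⁻¹ = (u j - u i) / (u i * u j) by field_simp,
      div_div_div_cancel_right₀ (mul_ne_zero hi hj)]
  have e2 : ∀ i, ((u i)⁻¹ - s) / (1 - s * (u i)⁻¹) = (1 - s * u i) / (u i - s) := fun i => by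
    have hi := h0 i
    rw [show (u i)⁻¹ - s = (1 - s * u i) / u i by field_simp,
      show 1 - s * (u i)⁻¹ = (u i - s) / u i by field_simp, div_div_div_cancel_right₀ hi]
  have e3 : (∏ i, 1 / u i) * (∏ i, (1 - s * (u i)⁻¹))⁻¹ = ∏ i, 1 / (u i - s) := by
    rw [← Finset.prod_inv_distrib, ← Finset.prod_mul_distrib]
    refine Finset.prod_congr rfl fun i _ => ?_
    have hi := h0 i
    rw [show 1 - s * (u i)⁻¹ = (u i - s) / u i by field_simp, inv_div]
    field_simp
  have e4 : ∀ τ : Equiv.Perm (Fin k), ∏ i, 1 / (u (τ i) - s) = ∏ i, 1 / (u i - s) := fun τ =>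
    Equiv.prod_comp τ fun i => 1 / (u i - s)
  simp only [F, e1, e2, Finset.prod_mul_distrib, e4]
  rw [div_eq_mul_inv, ← e3, Finset.mul_sum, Finset.mul_sum, Finset.mul_sum]
  refine Finset.sum_congr rfl fun τ _ => ?_
  ring

/-- The symmetric integrand is a multiple of the symmetrization of the nested one. -/
lemma symmetricIntegrand_eq_sum {q s : ℂ} {lam mu : Signature k} (hc : cConst q s lam ≠ 0)
    {u : Fin k → ℂ} (h0 : ∀ i, u i ≠ 0) (hne : ∀ a b, u a - q * u b ≠ 0) :
    symmetricIntegrand q s lam mu u =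
      ∑ τ : Equiv.Perm (Fin k), ((1 - q) ^ k * (cConst q s lam)⁻¹) *
        nestedIntegrand q s lam mu (u ∘ τ) := by
  have e : symmetricIntegrand q s lam mu u = F q s lam u *
      (∏ α, ∏ β ∈ Finset.univ.erase α, (u α - u β) / (u α - q * u β)) *
      ((∏ i, 1 / u i) * F q s mu fun i => (u i)⁻¹) := by
    rw [symmetricIntegrand]
    ring
  rw [e, mul_F_inv mu h0, Finset.mul_sum, Finset.mul_sum]
  refine Finset.sum_congr rfl fun τ _ => ?_
  have h1 := prod_ne_mul_prod_Ioi (v := u ∘ τ) (q := q) fun a b => hne _ _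
  simp only [Function.comp_apply] at h1
  rw [prod_erase_comp_perm τ fun a b => (u a - u b) / (u a - q * u b)] at h1
  rw [nestedIntegrand, Fc, F_comp_perm]
  simp only [Function.comp_apply]
  rw [← h1]
  have key : ∀ A B C D E c : ℂ, c ≠ 0 →
      A * B * (C * (D * E)) = C * c⁻¹ * (B * D * (c * A) * E) := by
    intro A B C D E c h
    field_simp
  exact key _ _ _ _ _ _ hc

/-- The point `s` itself is encircled because `k` is positive. -/
lemma IsLarge.isNested {q s : ℝ} (hk : 1 ≤ k) {γ : Contour} (h : IsLarge q s k γ) :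
    IsNested q s fun _ : Fin k => γ where
  encircles _ := by simpa using h.encircles 0 hk
  leaves_outside _ := h.leaves_outside
  nested _ _ _ := h.nested
  small _ _ z hz := (h.nested z hz).1

theorem spatial_biorthogonality {q s : ℝ} (hq0 : 0 < q) (hq1 : q < 1) (hs0 : -1 < s)
    (hs1 : s < 0) (hk : 1 ≤ k) (lam mu : Signature k) {γ : Contour} (h : IsLarge q s k γ) :
    ContourIntegrable (fun _ : Fin k => γ) (symmetricIntegrand q s lam mu) ∧
      cConst q s lam / ((1 - (q : ℂ)) ^ k * (k.factorial : ℂ)) *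
        contourIntegral (fun _ : Fin k => γ) (symmetricIntegrand q s lam mu) =
        if lam = mu then 1 else 0 := by
  have hn := h.isNested hk
  have hq : 1 - (q : ℂ) ≠ 0 := by simpa using one_sub_mul_pow_ne_zero hq0 hq1 hq1 0
  have hc : cConst q s lam ≠ 0 := by
    rw [cConst_eq]
    refine Finset.prod_ne_zero_iff.2 fun a _ => div_ne_zero ?_ ?_
    · have := one_sub_mul_pow_ne_zero (c := s ^ 2) hq0 hq1 (by nlinarith) (laterEqual lam.1 a)
      rwa [Complex.ofReal_pow] at this
    · rw [pow_succ']
      exact one_sub_mul_pow_ne_zero hq0 hq1 hq1 _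
  have hne : ∀ u : Fin k → ℂ, (∀ i, u i ∈ γ.trace) → ∀ a b, u a - q * u b ≠ 0 :=
    fun u hu a b e => (h.nested _ (hu b)).1 (sub_eq_zero.1 e ▸ hu a)
  have h0 : ∀ u : Fin k → ℂ, (∀ i, u i ∈ γ.trace) → ∀ i, u i ≠ 0 := fun u hu i e => by
    have := (h.nested _ (hu i)).1
    rw [e, mul_zero, ← e] at this
    exact this (hu i)
  have e : ∀ u : Fin k → ℂ, (∀ i, u i ∈ γ.trace) → symmetricIntegrand q s lam mu u =
      ∑ τ : Equiv.Perm (Fin k), ((1 - (q : ℂ)) ^ k * (cConst q s lam)⁻¹) *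
        nestedIntegrand q s lam mu (u ∘ τ) := fun u hu =>
    symmetricIntegrand_eq_sum hc (h0 u hu) (hne u hu)
  have hint : ∀ τ : Equiv.Perm (Fin k), ContourIntegrable (fun _ : Fin k => γ) fun u =>
      ((1 - (q : ℂ)) ^ k * (cConst q s lam)⁻¹) * nestedIntegrand q s lam mu (u ∘ τ) := by
    intro τ
    have hcont : ContinuousOn (nestedIntegrand (q : ℂ) s lam mu) (univ.pi fun _ => γ.trace) := by
      refine ContinuousOn.congr (continuousOn_const.mul
        (continuousOn_finsetSum Finset.univ fun σ _ => continuousOn_permTerm hn lam mu σ))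
        fun u hu => nestedIntegrand_eq_sum _ (hn.sub_ne_zero fun i => hu i (mem_univ i)) lam mu
    refine contourIntegrable_of_continuousOn (continuousOn_const.mul
      (hcont.comp (Continuous.continuousOn (by fun_prop)) fun u hu i _ => hu (τ i) (mem_univ _)))
  refine ⟨(ContourIntegrable.sum _ fun τ _ => hint τ).congr fun u hu => (e u hu).symm, ?_⟩
  rw [contourIntegral_congr e, contourIntegral_sum _ fun τ _ => hint τ]
  simp only [contourIntegral_const_mul]
  simp only [contourIntegral_comp_perm γ _ (nestedIntegrand (q : ℂ) s lam mu)]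
  rw [Finset.sum_const, Finset.card_univ, Fintype.card_perm, Fintype.card_fin, nsmul_eq_mul,
    (nested_biorthogonality hq0 hq1 hs0 hs1 lam mu hn).2]
  have hk0 : (k.factorial : ℂ) ≠ 0 := by exact_mod_cast k.factorial_ne_zero
  field_simp

end SpinOrthogonality

theorem theorem7p4 (q s : ℝ) (hq0 : 0 < q) (hq1 : q < 1) (hs0 : -1 < s) (hs1 : s < 0)
    (k : ℕ) (hk : 1 ≤ k) (lam mu : SpinOrthogonality.Signature k) :
    (∀ γ : Fin k → SpinOrthogonality.Contour, SpinOrthogonality.IsNested q s γ →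
      SpinOrthogonality.ContourIntegrable γ (SpinOrthogonality.nestedIntegrand q s lam mu) ∧
      SpinOrthogonality.contourIntegral γ (SpinOrthogonality.nestedIntegrand q s lam mu) =
        if lam = mu then 1 else 0) ∧
    (∀ γ : SpinOrthogonality.Contour, SpinOrthogonality.IsLarge q s k γ →
      SpinOrthogonality.ContourIntegrable (fun _ : Fin k => γ)
        (SpinOrthogonality.symmetricIntegrand q s lam mu) ∧
      SpinOrthogonality.cConst q s lam / ((1 - (q : ℂ)) ^ k * (k.factorial : ℂ)) *
        SpinOrthogonality.contourIntegral (fun _ : Fin k => γ)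
          (SpinOrthogonality.symmetricIntegrand q s lam mu) =
        if lam = mu then 1 else 0) :=
  ⟨fun _ h => SpinOrthogonality.nested_biorthogonality hq0 hq1 hs0 hs1 lam mu h,
    fun _ h => SpinOrthogonality.spatial_biorthogonality hq0 hq1 hs0 hs1 hk lam mu h⟩
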